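/- Let $K$ be a number field with ring of integers $O_K$. Let $\pi:\mathcal X\to\operatorname{Spec}O_K$ be an integral scheme, proper and flat over $O_K$, whose generic fibre $X_K$ is smooth of relative dimension one over $K$. Let $H$ be a line bundle and $E$ a vector bundle of rank $m$ on $\mathcal X$, and let $P_1,\dots,P_s:\operatorname{Spec}O_K\to\mathcal X$ be sections of $\pi$ with pairwise disjoint images; write $p_j\in X_K(K)$ for the generic point of $P_j$. For every $j$ we suppose given an isomorphism of $\operatorname{Spf}O_K[\![Z]\!]$ with the completion of $\mathcal X$ along $P_j$, and trivializations of $E$ and $H$ over this completion. By means of them a formal section $f_j\in H^0(\widehat X_{p_j};E_K^\vee)$ over the completion of $X_K$ at $p_j$ is an $m$-tuple of power series $\sum_{\ell\ge 0}a_\ell(k)Z^\ell\in K[\![Z]\!]$, $1\le k\le m$. *LG-germs.* Absolute values $\|\cdot\|_v$ at finite places are the normalized ones, $\|a\|_v=\#(O_K/\mathfrak p_v)^{-v(a)}$. The section $f_j$ is an LG-germ of type $\alpha$ if (a) for every place $v$ of $K$ and every $k$ the series $\sum_\ell a_\ell(k)Z^\ell$ has positive radius of convergence at $v$; (b) there are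 a finite set $S$ of places, containing the infinite ones, and constants $C_v>0$ $(v\notin S)$ with $\|a_\ell(k)\|_v\le C_v^\ell/\|\ell!\|_v^\alpha$ for all $v\notin S$, all $k$ and all $\ell\ge 0$; (c) $\prod_{v\notin S}C_v<\infty$, that is, the products of the $C_v$ over the finite sets of places outside $S$ are bounded above. *The maps $\gamma_x^i$.* For an integer $x\ge 0$ let $G_x=H^0(\mathcal X;E\otimes H^{\otimes x})$. Contraction with $f=(f_1,\dots,f_s)$ gives an $O_K$-linear map $\langle\cdot;f\rangle:G_x\to\bigoplus_jH^0(\widehat X_{p_j};H_K^{\otimes x})$. Let $\widehat{\mathcal X}^i_{p_j}$ be the $i$-th infinitesimal neighbourhood of $P_j$ in $\mathcal X$ (defined by the $i$-th power of the ideal of $P_j$), and let $G_x^i\subseteq G_x$ be the kernel of the composite of $\langle\cdot;f\rangle$ with the restriction to $\bigoplus_jH^0(\widehat{\mathcal X}^i_{p_j};H^{\otimes x})\otimes K$. Let $T_{p_j}\mathcal X$ be the dual of $P_j^*\Omega^1_{\mathcal X/O_K}$. The exact sequences $$0\to\bigoplus_jH^0(P_j;H^{\otimes x}\otimes (T_{p_j}\mathcal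 X)^{\otimes -i})\to\bigoplus_jH^0(\widehat{\mathcal X}^{i+1}_{p_j};H^{\otimes x})\to\bigoplus_jH^0(\widehat{\mathcal X}^{i}_{p_j};H^{\otimes x})$$ induce an injective $O_K$-linear map $$\gamma_x^i:\ G_x^i/G_x^{i+1}\longrightarrow\Big(\bigoplus_jH^0(P_j;H^{\otimes x}\otimes (T_{p_j}\mathcal X)^{\otimes -i})\Big)\otimes_{O_K} K .$$ For every finite place $v$, with completion $K_v$ and valuation ring $O_v$, let $\|\gamma_x^i\|_v$ be the operator norm of the $K_v$-linear extension of $\gamma_x^i$, both sides being normed by their integral structures: the unit balls are the $O_v$-submodules generated by $G_x^i/G_x^{i+1}$ and by $\bigoplus_jH^0(P_j;H^{\otimes x}\otimes (T_{p_j}\mathcal X)^{\otimes -i})$. **Theorem.** Let $\alpha\ge 0$ and suppose that $f_1,\dots,f_s$ are LG-germs of type $\alpha$. Then there is a real constant $C$ such that, for all integers $i,x\ge 0$ which are not both zero and for which $\gamma_x^i\ne 0$ (equivalently $G_x^i\neq G_x^{i+1}$), one has $\|\gamma_x^i\|_v>0$ for every finite place $v$, the series $\sum_v\log\|\gamma_x^i\|_v$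 over the finite places converges absolutely, and $$\sum_{v\ \mathrm{finite}}\log\|\gamma_x^i\|_v\ \le\ [K:\mathbb Q]\,\alpha\, i\log i+C(i+x),$$ where $0\log 0=0$. (If $\gamma_x^i=0$, the sum is to be read as $-\infty$.) -/

import Mathlib

open CategoryTheory AlgebraicGeometry PowerSeries NumberField IsDedekindDomain
open scoped TensorProduct

universe u

noncomputable section

namespace LGGerms

/-! ### Vector bundles on a scheme and their twists by powers of a line bundle -/

section Bundles

variable {𝒳 : Scheme.{u}}

/-- `e` is a frame (basis of sections) of the sheaf of modules `E` over the open set `U`: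
over every open `V ≤ U` its restriction is a basis of the `Γ(𝒳, V)`-module `Γ(E, V)`. -/
def IsFrame (E : 𝒳.Modules) (U : 𝒳.Opens) {m : ℕ} (e : Fin m → Γ(E, U)) : Prop :=
  ∀ (V : 𝒳.Opens) (hV : V ≤ U), Function.Bijective
    (fun c : Fin m → Γ(𝒳, V) => ∑ k, c k • E.presheaf.map (homOfLE hV).op (e k))

/-- `E` is a vector bundle of rank `m`: a sheaf of modules that has a frame of length `m` in a
neighbourhood of every point. -/
def IsVectorBundle (E : 𝒳.Modules) (m : ℕ) : Prop :=
  ∀ q : 𝒳, ∃ (U : 𝒳.Opens) (_ : q ∈ U) (e : Fin m → Γ(E, U)), IsFrame E U e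

lemma res_res (E : 𝒳.Modules) {U V W : 𝒳.Opens} (hVU : V ≤ U) (hWV : W ≤ V) (t : Γ(E, U)) :
    E.presheaf.map (homOfLE hWV).op (E.presheaf.map (homOfLE hVU).op t) =
      E.presheaf.map (homOfLE (hWV.trans hVU)).op t := by
  rw [← ConcreteCategory.comp_apply, ← Functor.map_comp]
  rfl

lemma res_self (E : 𝒳.Modules) {U : 𝒳.Opens} (t : Γ(E, U)) :
    E.presheaf.map (homOfLE le_rfl).op t = t :=
  congr($(E.presheaf.map_id (.op U)) t)

lemma IsFrame.restrict {E : 𝒳.Modules} {U V : 𝒳.Opens} {m : ℕ} {e : Fin m → Γ(E, U)}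
    (he : IsFrame E U e) (hVU : V ≤ U) :
    IsFrame E V (fun k => E.presheaf.map (homOfLE hVU).op (e k)) := by
  intro W hWV
  simp only [res_res]
  exact he W (hWV.trans hVU)

/-- The generators over `U` of a line bundle `H`. -/
abbrev Generator (H : 𝒳.Modules) (U : 𝒳.Opens) : Type u :=
  {h : Γ(H, U) // IsFrame H U (fun _ : Fin 1 => h)}

lemma Generator.exists_unit {H : 𝒳.Modules} {U : 𝒳.Opens} (h h' : Generator H U) :
    ∃ a : (Γ(𝒳, U))ˣ, h'.1 = (a : Γ(𝒳, U)) • h.1 := by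
  have key (h h' : Generator H U) : ∃ a : Γ(𝒳, U), h'.1 = a • h.1 := by
    obtain ⟨c, hc⟩ := (h.2 U le_rfl).2 h'.1
    refine ⟨c 0, hc.symm.trans ?_⟩
    simp only [res_self, Fin.sum_univ_one, Fin.isValue]
  obtain ⟨a, ha⟩ := key h h'
  obtain ⟨b, hb⟩ := key h' h
  have hab : b * a = 1 := by
    have := (h.2 U le_rfl).1 (a₁ := fun _ => b * a) (a₂ := fun _ => 1) (by
      simp only [res_self, Fin.sum_univ_one, one_smul, mul_smul, ← ha, ← hb])
    exact congrFun this 0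
  exact ⟨⟨a, b, (mul_comm _ _).trans hab, hab⟩, ha⟩

end Bundles

section Model

variable {K : Type u} [Field K] {𝒳 : Scheme.{u}}

/-- The homomorphism `𝓞 K → Γ(𝒳, U)` given by a morphism `π : 𝒳 ⟶ Spec 𝓞 K`. -/
def structHom (π : 𝒳 ⟶ Spec (.of (𝓞 K))) (U : 𝒳.Opens) : 𝓞 K →+* Γ(𝒳, U) :=
  ((Scheme.ΓSpecIso (.of (𝓞 K))).inv ≫ π.appTop ≫
    𝒳.presheaf.map (homOfLE (le_top : U ≤ ⊤)).op).hom

/-- The sections of `E` over `U`, as an `𝓞 K`-module. -/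
def Sec (_ : 𝒳 ⟶ Spec (.of (𝓞 K))) (E : 𝒳.Modules) (U : 𝒳.Opens) : Type u := Γ(E, U)

variable (π : 𝒳 ⟶ Spec (.of (𝓞 K))) (E H : 𝒳.Modules)

instance (U : 𝒳.Opens) : AddCommGroup (Sec π E U) := inferInstanceAs (AddCommGroup Γ(E, U))

instance (U : 𝒳.Opens) : Module Γ(𝒳, U) (Sec π E U) := inferInstanceAs (Module Γ(𝒳, U) Γ(E, U))

instance (U : 𝒳.Opens) : Module (𝓞 K) (Sec π E U) := Module.compHom (Sec π E U) (structHom π U)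

/-- Restriction of sections. -/
def Sec.res {U V : 𝒳.Opens} (hVU : V ≤ U) (t : Sec π E U) : Sec π E V :=
  E.presheaf.map (homOfLE hVU).op t

lemma Sec.smul_def {U : 𝒳.Opens} (c : 𝓞 K) (t : Sec π E U) : c • t = structHom π U c • t := rfl

lemma res_structHom {U V : 𝒳.Opens} (hVU : V ≤ U) (c : 𝓞 K) :
    𝒳.presheaf.map (homOfLE hVU).op (structHom π U c) = structHom π V c := by
  simp only [structHom]
  rw [← CommRingCat.comp_apply]
  simp only [Category.assoc, ← Functor.map_comp]
  rfl

lemma Sec.res_add {U V : 𝒳.Opens} (hVU : V ≤ U) (s t : Sec π E U) :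
    Sec.res π E hVU (s + t) = Sec.res π E hVU s + Sec.res π E hVU t :=
  map_add (E.presheaf.map (homOfLE hVU).op).hom s t

lemma Sec.res_zero {U V : 𝒳.Opens} (hVU : V ≤ U) : Sec.res π E hVU 0 = 0 :=
  map_zero (E.presheaf.map (homOfLE hVU).op).hom

lemma Sec.res_smul {U V : 𝒳.Opens} (hVU : V ≤ U) (c : 𝓞 K) (t : Sec π E U) :
    Sec.res π E hVU (c • t) = c • Sec.res π E hVU t := by
  rw [Sec.smul_def, Sec.smul_def, ← res_structHom π hVU c]
  exact E.map_smul (homOfLE hVU) (structHom π U c) t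

/-- The submodule of compatible families that underlies `TwistedSections`. -/
def compatibleFamilies (x : ℕ) :
    Submodule (𝓞 K) (∀ U : 𝒳.Opens, Generator H U → Sec π E U) where
  carrier := {s | ∀ (U V : 𝒳.Opens) (hVU : V ≤ U) (h : Generator H U) (h' : Generator H V)
    (a : (Γ(𝒳, V))ˣ), h'.1 = (a : Γ(𝒳, V)) • H.presheaf.map (homOfLE hVU).op h.1 →
      (a : Γ(𝒳, V)) ^ x • s V h' = Sec.res π E hVU (s U h)}
  add_mem' := by
    intro s t hs ht U V hVU h h' a ha
    rw [Pi.add_apply, Pi.add_apply, Pi.add_apply, Pi.add_apply, smul_add, Sec.res_add,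
      hs U V hVU h h' a ha, ht U V hVU h h' a ha]
  zero_mem' := by
    intro U V hVU h h' a ha
    exact (smul_zero _).trans (Sec.res_zero π E hVU).symm
  smul_mem' := by
    intro c s hs U V hVU h h' a ha
    rw [Pi.smul_apply, Pi.smul_apply, Pi.smul_apply, Pi.smul_apply, Sec.res_smul,
      ← hs U V hVU h h' a ha, Sec.smul_def, Sec.smul_def, smul_smul, smul_smul, mul_comm]

/-- The `𝓞 K`-module `G_x = H⁰(𝒳, E ⊗ H^{⊗ x})` for a line bundle `H`. A section `s` of
`E ⊗ H^{⊗ x}` is given by its values relative to the local generators of `H`: if `h` generates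
`H` over `U` then `s = s(U, h) ⊗ h^{⊗ x}` over `U` for a unique `s(U, h) ∈ Γ(E, U)`, and
`a ^ x · s(V, a · h) = s(U, h)` over `V ≤ U` for every unit `a` on `V`. Conversely, such a
compatible family glues to a section of `E ⊗ H^{⊗ x}`. -/
def TwistedSections (x : ℕ) : Type u := compatibleFamilies π E H x

instance (x : ℕ) : AddCommGroup (TwistedSections π E H x) :=
  inferInstanceAs (AddCommGroup (compatibleFamilies π E H x))

instance (x : ℕ) : Module (𝓞 K) (TwistedSections π E H x) :=
  inferInstanceAs (Module (𝓞 K) (compatibleFamilies π E H x))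

/-- The value `s(U, h)` of a section `s` of `E ⊗ H^{⊗ x}` relative to a generator `h` of `H`. -/
def TwistedSections.val {π : 𝒳 ⟶ Spec (.of (𝓞 K))} {E H : 𝒳.Modules} {x : ℕ}
    (s : TwistedSections π E H x) (U : 𝒳.Opens) (h : Generator H U) : Sec π E U :=
  s.1 U h

lemma TwistedSections.val_add {x : ℕ} (s t : TwistedSections π E H x) (U : 𝒳.Opens)
    (h : Generator H U) : (s + t).val U h = s.val U h + t.val U h := rfl

lemma TwistedSections.val_zero {x : ℕ} (U : 𝒳.Opens) (h : Generator H U) :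
    (0 : TwistedSections π E H x).val U h = 0 := rfl

lemma TwistedSections.val_smul {x : ℕ} (r : 𝓞 K) (s : TwistedSections π E H x) (U : 𝒳.Opens)
    (h : Generator H U) : (r • s).val U h = r • s.val U h := rfl

/-! ### Formal neighbourhoods of sections -/

/-- An isomorphism of `Spf 𝓞 K⟦Z⟧` with the formal completion of `𝒳` along the section `P`.
It is given by a morphism `Spec 𝓞 K⟦Z⟧ ⟶ 𝒳` over `Spec 𝓞 K` that extends `P` (which is the
locus `Z = 0`) and that identifies `Spec (𝓞 K⟦Z⟧ / Z ^ n)`, for every `n`, with the `n`-th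
infinitesimal neighbourhood of `P`, the closed subscheme of `𝒳` defined by the `n`-th power of
the ideal of `P`. -/
structure FormalChart (P : Spec (.of (𝓞 K)) ⟶ 𝒳) where
  /-- The underlying morphism. -/
  map : Spec (.of (𝓞 K)⟦X⟧) ⟶ 𝒳
  map_comp : map ≫ π = Spec.map (CommRingCat.ofHom (C (R := 𝓞 K)))
  extends_section : Spec.map (CommRingCat.ofHom (constantCoeff (R := 𝓞 K))) ≫ map = P
  isClosedImmersion (n : ℕ) : IsClosedImmersion
    (Spec.map (CommRingCat.ofHom (Ideal.Quotient.mk (Ideal.span {(X : (𝓞 K)⟦X⟧) ^ n}))) ≫ map)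
  ker_eq (n : ℕ) :
    (Spec.map (CommRingCat.ofHom
      (Ideal.Quotient.mk (Ideal.span {(X : (𝓞 K)⟦X⟧) ^ n}))) ≫ map).ker = P.ker ^ n

variable {E} in
/-- The function on `φ⁻¹ U` that a morphism `t : E ⟶ φ_* 𝒪_Y` attaches to a section of `E`
over `U`. -/
def functionOf {Y : Scheme.{u}} {φ : Y ⟶ 𝒳}
    (t : E ⟶ (Scheme.Modules.pushforward φ).obj (SheafOfModules.unit Y.ringCatSheaf : Y.Modules))
    (U : 𝒳.Opens) (s : Γ(E, U)) : Γ(Y, φ ⁻¹ᵁ U) :=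
  t.app U s

/-- A trivialization of the pullback of the rank `m` vector bundle `E` along `φ : Y ⟶ 𝒳`:
a morphism `φ^* E ⟶ 𝒪_Y ^ m`, written through its components `E ⟶ φ_* 𝒪_Y`, which is an
isomorphism, that is, which maps frames of `E` to invertible matrices. -/
structure Trivialization {Y : Scheme.{u}} (φ : Y ⟶ 𝒳) (m : ℕ) where
  /-- The components of the trivialization. -/
  coord : Fin m →
    (E ⟶ (Scheme.Modules.pushforward φ).obj (SheafOfModules.unit Y.ringCatSheaf : Y.Modules))
  isUnit_det (U : 𝒳.Opens) (e : Fin m → Γ(E, U)) (he : IsFrame E U e) :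
    IsUnit (Matrix.of (fun k l => functionOf (coord k) U (e l))).det

variable (K) in
/-- The morphism `Spec K⟦Z⟧ ⟶ Spec 𝓞 K⟦Z⟧`; the closed point of `Spec K⟦Z⟧` is mapped to the
generic point of the locus `Z = 0`. -/
def genericMap : Spec (.of K⟦X⟧) ⟶ Spec (.of (𝓞 K)⟦X⟧) :=
  Spec.map (CommRingCat.ofHom (PowerSeries.map (algebraMap (𝓞 K) K)))

variable {π} {P : Spec (.of (𝓞 K)) ⟶ 𝒳}

/-- The `K`-rational point `p_K` of the generic fibre that extends to the section `P`, as a point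
of the topological space of `𝒳`. -/
def FormalChart.point (c : FormalChart π P) : 𝒳 :=
  c.map (genericMap K (IsLocalRing.closedPoint K⟦X⟧))

/-- The power series expansion at `p_K` of a function on the preimage of a neighbourhood of
`p_K`. -/
def FormalChart.expand (c : FormalChart π P) (U : 𝒳.Opens) (hU : c.point ∈ U) :
    Γ(Spec (.of (𝓞 K)⟦X⟧), c.map ⁻¹ᵁ U) →+* K⟦X⟧ :=
  ((Spec (.of (𝓞 K)⟦X⟧)).presheaf.germ (c.map ⁻¹ᵁ U)
      (genericMap K (IsLocalRing.closedPoint K⟦X⟧)) hU ≫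
    Scheme.stalkClosedPointTo (R := .of K⟦X⟧) (genericMap K)).hom

lemma FormalChart.expand_structHom (c : FormalChart π P) (U : 𝒳.Opens) (hU : c.point ∈ U)
    (r : 𝓞 K) : c.expand U hU (c.map.app U (structHom π U r)) = C (algebraMap (𝓞 K) K r) := by
  have h1 : (Spec (.of (𝓞 K)⟦X⟧)).presheaf.map (homOfLE (le_top : c.map ⁻¹ᵁ U ≤ ⊤)).op ≫
      (Spec (.of (𝓞 K)⟦X⟧)).presheaf.germ (c.map ⁻¹ᵁ U)
        (genericMap K (IsLocalRing.closedPoint K⟦X⟧)) hU =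
      (Spec (.of (𝓞 K)⟦X⟧)).presheaf.germ ⊤
        (genericMap K (IsLocalRing.closedPoint K⟦X⟧)) trivial :=
    TopCat.Presheaf.germ_res _ _ _ _
  have h2 : (Spec (.of (𝓞 K)⟦X⟧)).presheaf.germ ⊤
      (genericMap K (IsLocalRing.closedPoint K⟦X⟧)) trivial ≫
        Scheme.stalkClosedPointTo (R := .of K⟦X⟧) (genericMap K) =
      (Scheme.ΓSpecIso (.of (𝓞 K)⟦X⟧)).hom ≫
        CommRingCat.ofHom (PowerSeries.map (algebraMap (𝓞 K) K)) :=
    Scheme.germ_stalkClosedPointTo_Spec _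
  have h3 : 𝒳.presheaf.map (homOfLE (le_top : U ≤ ⊤)).op ≫ c.map.app U = c.map.appTop ≫
      (Spec (.of (𝓞 K)⟦X⟧)).presheaf.map (homOfLE (le_top : c.map ⁻¹ᵁ U ≤ ⊤)).op :=
    c.map.naturality _
  have h4 : (Scheme.ΓSpecIso (.of (𝓞 K))).inv ≫ π.appTop ≫ c.map.appTop =
      CommRingCat.ofHom (C (R := 𝓞 K)) ≫ (Scheme.ΓSpecIso (.of (𝓞 K)⟦X⟧)).inv := by
    rw [Scheme.ΓSpecIso_inv_naturality, ← c.map_comp, Scheme.Hom.comp_appTop]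
  have key : ((Scheme.ΓSpecIso (.of (𝓞 K))).inv ≫ π.appTop ≫
      𝒳.presheaf.map (homOfLE (le_top : U ≤ ⊤)).op) ≫ c.map.app U ≫
      ((Spec (.of (𝓞 K)⟦X⟧)).presheaf.germ (c.map ⁻¹ᵁ U)
        (genericMap K (IsLocalRing.closedPoint K⟦X⟧)) hU ≫
      Scheme.stalkClosedPointTo (R := .of K⟦X⟧) (genericMap K)) =
      CommRingCat.ofHom (C (R := 𝓞 K)) ≫
        CommRingCat.ofHom (PowerSeries.map (algebraMap (𝓞 K) K)) := by
    rw [Category.assoc, Category.assoc, reassoc_of% h3, reassoc_of% h1, h2, reassoc_of% h4,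
      Iso.inv_hom_id_assoc]
  refine (congr($(key).hom r)).trans ?_
  change PowerSeries.map (algebraMap (𝓞 K) K) (C r) = _
  rw [PowerSeries.map_C]

variable {E H}

/-- The `k`-th coordinate, in `K⟦Z⟧`, of a section of `E` over a neighbourhood of `p_K`. -/
def FormalChart.expandSection (c : FormalChart π P) {m : ℕ} (τ : Trivialization E c.map m)
    (k : Fin m) (U : 𝒳.Opens) (hU : c.point ∈ U) (t : Γ(E, U)) : K⟦X⟧ :=
  c.expand U hU (functionOf (τ.coord k) U t)

lemma FormalChart.expandSection_add (c : FormalChart π P) {m : ℕ} (τ : Trivialization E c.map m)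
    (k : Fin m) (U : 𝒳.Opens) (hU : c.point ∈ U) (s t : Sec π E U) :
    c.expandSection τ k U hU (s + t) = c.expandSection τ k U hU s + c.expandSection τ k U hU t :=
  (congrArg (c.expand U hU) (map_add ((τ.coord k).app U).hom s t)).trans
    (map_add (c.expand U hU) _ _)

lemma FormalChart.expandSection_smul' (c : FormalChart π P) {m : ℕ}
    (τ : Trivialization E c.map m) (k : Fin m) (U : 𝒳.Opens) (hU : c.point ∈ U) (g : Γ(𝒳, U))
    (t : Γ(E, U)) : c.expandSection τ k U hU (g • t) =
      c.expand U hU (c.map.app U g) * c.expandSection τ k U hU t :=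
  (congrArg (c.expand U hU) ((τ.coord k).app_smul g t)).trans (map_mul (c.expand U hU) _ _)

lemma FormalChart.expandSection_smul (c : FormalChart π P) {m : ℕ}
    (τ : Trivialization E c.map m) (k : Fin m) (U : 𝒳.Opens) (hU : c.point ∈ U) (r : 𝓞 K)
    (t : Sec π E U) :
    c.expandSection τ k U hU (r • t) =
      C (algebraMap (𝓞 K) K r) * c.expandSection τ k U hU t := by
  rw [Sec.smul_def, ← c.expand_structHom U hU r]
  exact c.expandSection_smul' τ k U hU (structHom π U r) t

lemma FormalChart.expandSection_res (c : FormalChart π P) {m : ℕ}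
    (τ : Trivialization E c.map m) (k : Fin m) {U V : 𝒳.Opens} (hVU : V ≤ U) (hV : c.point ∈ V)
    (t : Γ(E, U)) : c.expandSection τ k V hV (E.presheaf.map (homOfLE hVU).op t) =
      c.expandSection τ k U (hVU hV) t := by
  have h1 : functionOf (τ.coord k) V (E.presheaf.map (homOfLE hVU).op t) =
      (Spec (.of (𝓞 K)⟦X⟧)).presheaf.map (homOfLE fun _ h => hVU h :
        c.map ⁻¹ᵁ V ⟶ c.map ⁻¹ᵁ U).op (functionOf (τ.coord k) U t) :=
    congr($((τ.coord k).mapPresheaf.naturality (homOfLE hVU).op) t)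
  have h2 := TopCat.Presheaf.germ_res (Spec (.of (𝓞 K)⟦X⟧)).presheaf
    (homOfLE fun _ h => hVU h : c.map ⁻¹ᵁ V ⟶ c.map ⁻¹ᵁ U)
    (genericMap K (IsLocalRing.closedPoint K⟦X⟧)) hV
  rw [expandSection, h1]
  exact congr((Scheme.stalkClosedPointTo (R := .of K⟦X⟧) (genericMap K)).hom
    ($h2 (functionOf (τ.coord k) U t)))

variable (π E H P) in
/-- The isomorphisms that are fixed along a section `P`: a formal coordinate `Z` on `𝒳` along `P`
and trivializations of the restrictions of `E` and `H` to the formal neighbourhood of `P`. -/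
structure FormalFrame (m : ℕ) where
  /-- The formal coordinate. -/
  chart : FormalChart π P
  /-- The trivialization of `E`. -/
  trivE : Trivialization E chart.map m
  /-- The trivialization of `H`. -/
  trivH : Trivialization H chart.map 1

/-- A neighbourhood of `p_K` over which the line bundle `H` has a generator. -/
def FormalChart.nhd (c : FormalChart π P) (hH : IsVectorBundle H 1) : 𝒳.Opens :=
  (hH c.point).choose

lemma FormalChart.point_mem_nhd (c : FormalChart π P) (hH : IsVectorBundle H 1) :
    c.point ∈ c.nhd hH :=
  (hH c.point).choose_spec.choose

/-- A generator of `H` near `p_K`. -/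
def FormalChart.gen (c : FormalChart π P) (hH : IsVectorBundle H 1) :
    Generator H (c.nhd hH) :=
  ⟨(hH c.point).choose_spec.choose_spec.choose 0, by
    have h := (hH c.point).choose_spec.choose_spec.choose_spec
    have h' : (fun _ : Fin 1 => (hH c.point).choose_spec.choose_spec.choose 0) =
        (hH c.point).choose_spec.choose_spec.choose :=
      funext fun k => congrArg _ (Subsingleton.elim 0 k)
    exact h'.symm ▸ h⟩

/-- The map `⟨·; f⟩ : G_x → H⁰(𝒳̂_p; H^{⊗ x}) ⊗ K = K⟦Z⟧` for a formal germ
`f = (f_1, …, f_m) ∈ K⟦Z⟧ ^ m` of section of the dual of `E` at `p_K`. The section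
`s(U, h) ⊗ h^{⊗ x}` is mapped to `(∑ k, s(U, h)_k * f_k) * h ^ x`, where `s(U, h)_k` and `h` are
expanded in the fixed trivializations; this does not depend on the neighbourhood `U` of `p_K` nor
on the generator `h` of `H` over `U`, see `pairing_eq`. -/
def pairing {m : ℕ} (F : FormalFrame π E H P m) (hH : IsVectorBundle H 1) (f : Fin m → K⟦X⟧)
    (x : ℕ) : TwistedSections π E H x →+ K⟦X⟧ where
  toFun s := (∑ k, F.chart.expandSection F.trivE k (F.chart.nhd hH) (F.chart.point_mem_nhd hH)
      (s.val (F.chart.nhd hH) (F.chart.gen hH)) * f k) *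
    F.chart.expandSection F.trivH 0 (F.chart.nhd hH) (F.chart.point_mem_nhd hH)
      (F.chart.gen hH).1 ^ x
  map_zero' := by
    have h (k : Fin m) : F.chart.expandSection F.trivE k (F.chart.nhd hH)
        (F.chart.point_mem_nhd hH) (0 : Sec π E (F.chart.nhd hH)) = 0 := by
      have := F.chart.expandSection_add F.trivE k (F.chart.nhd hH)
        (F.chart.point_mem_nhd hH) 0 0
      rwa [add_zero, left_eq_add] at this
    refine mul_eq_zero_of_left (Finset.sum_eq_zero fun k _ => mul_eq_zero_of_left (h k) _) _
  map_add' s t := by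
    rw [← add_mul, ← Finset.sum_add_distrib]
    congr 1
    refine Finset.sum_congr rfl fun k _ => ?_
    rw [← add_mul]
    congr 1
    exact F.chart.expandSection_add F.trivE k _ _ _ _

lemma pairing_smul {m : ℕ} (F : FormalFrame π E H P m) (hH : IsVectorBundle H 1)
    (f : Fin m → K⟦X⟧) (x : ℕ) (r : 𝓞 K) (s : TwistedSections π E H x) :
    pairing F hH f x (r • s) = C (algebraMap (𝓞 K) K r) * pairing F hH f x s := by
  have h (k : Fin m) := F.chart.expandSection_smul F.trivE k (F.chart.nhd hH)
    (F.chart.point_mem_nhd hH) r (s.val (F.chart.nhd hH) (F.chart.gen hH))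
  change (∑ k, F.chart.expandSection F.trivE k _ _ (r • s.val _ _) * f k) * _ = _ * (_ * _)
  rw [← mul_assoc, Finset.mul_sum]
  congr 1
  refine Finset.sum_congr rfl fun k _ => ?_
  rw [← mul_assoc]
  congr 1
  exact h k

lemma pairing_eq {m : ℕ} (F : FormalFrame π E H P m) (hH : IsVectorBundle H 1)
    (f : Fin m → K⟦X⟧) (x : ℕ) (s : TwistedSections π E H x) (U : 𝒳.Opens)
    (hU : F.chart.point ∈ U) (h : Generator H U) :
    pairing F hH f x s = (∑ k : Fin m, F.chart.expandSection F.trivE k U hU (s.val U h) * f k) *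
      F.chart.expandSection F.trivH 0 U hU h.1 ^ x := by
  have key (V : 𝒳.Opens) (h₁ h₂ : Generator H V) (hV : F.chart.point ∈ V) :
      (∑ k : Fin m, F.chart.expandSection F.trivE k V hV (s.val V h₁) * f k) *
        F.chart.expandSection F.trivH 0 V hV h₁.1 ^ x =
      (∑ k : Fin m, F.chart.expandSection F.trivE k V hV (s.val V h₂) * f k) *
        F.chart.expandSection F.trivH 0 V hV h₂.1 ^ x := by
    obtain ⟨a, ha⟩ := h₁.exists_unit h₂
    have h3 : (a : Γ(𝒳, V)) ^ x • s.val V h₂ = s.val V h₁ :=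
      (s.2 V V le_rfl h₁ h₂ a (ha.trans (by rw [res_self]))).trans (res_self E _)
    have h4 (k : Fin m) := F.chart.expandSection_smul' F.trivE k V hV
      ((a : Γ(𝒳, V)) ^ x) (s.val V h₂)
    have h5 := F.chart.expandSection_smul' F.trivH 0 V hV (a : Γ(𝒳, V)) h₁.1
    have alg (A B : Fin m → K⟦X⟧) (b c d : K⟦X⟧) (hA : ∀ k, A k = b ^ x * B k) (hd : d = b * c) :
        (∑ k, A k * f k) * c ^ x = (∑ k, B k * f k) * d ^ x := by
      rw [hd, mul_pow, ← mul_assoc, Finset.sum_mul, Finset.sum_mul, Finset.sum_mul]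
      exact Finset.sum_congr rfl fun k _ => by rw [hA k]; ring
    refine alg _ _ _ _ _ (fun k => ?_) ((congrArg _ ha).trans h5)
    exact ((congrArg _ h3.symm).trans (h4 k)).trans
      (congrArg (· * _) (by simp only [map_pow]))
  have key' (U V : 𝒳.Opens) (hVU : V ≤ U) (hV : F.chart.point ∈ V) (h : Generator H U) :
      (∑ k : Fin m, F.chart.expandSection F.trivE k U (hVU hV) (s.val U h) * f k) *
        F.chart.expandSection F.trivH 0 U (hVU hV) h.1 ^ x =
      (∑ k : Fin m, F.chart.expandSection F.trivE k V hV
          (s.val V ⟨H.presheaf.map (homOfLE hVU).op h.1, h.2.restrict hVU⟩) * f k) *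
        F.chart.expandSection F.trivH 0 V hV (H.presheaf.map (homOfLE hVU).op h.1) ^ x := by
    have h3 := s.2 U V hVU h ⟨H.presheaf.map (homOfLE hVU).op h.1, h.2.restrict hVU⟩ 1
      (by rw [Units.val_one, one_smul])
    rw [Units.val_one, one_pow, one_smul] at h3
    rw [F.chart.expandSection_res]
    congr 1
    refine Finset.sum_congr rfl fun k _ => congrArg (· * f k) ?_
    refine ((F.chart.expandSection_res F.trivE k hVU hV (s.val U h)).symm.trans ?_)
    exact congrArg (F.chart.expandSection F.trivE k V hV) h3.symm
  have hV : F.chart.point ∈ F.chart.nhd hH ⊓ U := ⟨F.chart.point_mem_nhd hH, hU⟩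
  exact (key' _ _ inf_le_left hV (F.chart.gen hH)).trans
    ((key _ _ _ hV).trans (key' _ _ inf_le_right hV h).symm)

end Model

/-! ### The filtration of `G_x` and the maps `γ_x^i` -/

section Filtration

variable (K : Type u) [Field K]

/-- The functions on the `n`-th infinitesimal neighbourhood `Spec K⟦Z⟧ / Z ^ n` of `p_K`. In the
fixed trivialization of `H`, they are the sections of `H^{⊗ x}`. -/
def Jet (n : ℕ) : Type u := K⟦X⟧ ⧸ Ideal.span {(X : K⟦X⟧) ^ n}

instance (n : ℕ) : CommRing (Jet K n) :=
  inferInstanceAs (CommRing (K⟦X⟧ ⧸ Ideal.span {(X : K⟦X⟧) ^ n}))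

variable {K} in
/-- The restriction of a formal function to the `n`-th infinitesimal neighbourhood. -/
def Jet.mk (n : ℕ) : K⟦X⟧ →+* Jet K n := Ideal.Quotient.mk (Ideal.span {(X : K⟦X⟧) ^ n})

instance (n : ℕ) : Algebra (𝓞 K) (Jet K n) :=
  ((Jet.mk n).comp ((C (R := K)).comp (algebraMap (𝓞 K) K))).toAlgebra

lemma Jet.smul_mk (n : ℕ) (r : 𝓞 K) (g : K⟦X⟧) :
    r • Jet.mk n g = Jet.mk n (C (algebraMap (𝓞 K) K r) * g) := by
  rw [Algebra.smul_def, map_mul]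
  rfl

/-- The restriction map from the `(i + 1)`-st to the `i`-th infinitesimal neighbourhood. -/
def Jet.restrict (i : ℕ) : Jet K (i + 1) →ₐ[𝓞 K] Jet K i :=
  { Ideal.Quotient.factor (Ideal.span_singleton_le_span_singleton.mpr
      (pow_dvd_pow (X : K⟦X⟧) i.le_succ)) with
    commutes' := fun _ => rfl }

/-- The restriction map from the `(i + 1)`-st to the `i`-th infinitesimal neighbourhoods of the
`s` points. -/
def jetRestrict (s i : ℕ) : (Fin s → Jet K (i + 1)) →ₗ[𝓞 K] (Fin s → Jet K i) :=
  LinearMap.pi fun j => (Jet.restrict K i).toLinearMap ∘ₗ LinearMap.proj j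

/-- The kernel of the restriction map from the `(i + 1)`-st to the `i`-th infinitesimal
neighbourhoods of the points. By the exact sequence
`0 → ⊕ⱼ H⁰(p_j, H^{⊗ x} ⊗ T^{⊗ -i}) ⊗ K → ⊕ⱼ H⁰(X̂^{i+1}_{p_j}; H^{⊗ x}) →
⊕ⱼ H⁰(X̂^i_{p_j}; H^{⊗ x})` it is `⊕ⱼ H⁰(p_j, H^{⊗ x} ⊗ T^{⊗ -i}) ⊗ K`, where `T` is the
tangent line of `𝒳` along `P_j`. -/
abbrev LeadingTerms (s i : ℕ) : Submodule (𝓞 K) (Fin s → Jet K (i + 1)) :=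
  LinearMap.ker (jetRestrict K s i)

/-- The integral structure `⊕ⱼ H⁰(p_j, H^{⊗ x} ⊗ T^{⊗ -i})` of `LeadingTerms`: the leading terms
that are jets along the sections `P_j`, that is, with coefficients in `𝓞 K`. -/
def integralLeadingTerms (s i : ℕ) : Submodule (𝓞 K) (LeadingTerms K s i) where
  carrier := {w | ∀ j, ∃ g : (𝓞 K)⟦X⟧,
    w.1 j = Jet.mk (i + 1) (PowerSeries.map (algebraMap (𝓞 K) K) g)}
  add_mem' := by
    intro w w' hw hw' j
    obtain ⟨g, hg⟩ := hw j
    obtain ⟨g', hg'⟩ := hw' j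
    refine ⟨g + g', ?_⟩
    rw [map_add, map_add, ← hg, ← hg']
    rfl
  zero_mem' := fun j => ⟨0, by rw [map_zero, map_zero]; rfl⟩
  smul_mem' := by
    intro r w hw j
    obtain ⟨g, hg⟩ := hw j
    refine ⟨C r * g, ?_⟩
    rw [map_mul, PowerSeries.map_C, ← Jet.smul_mk, ← hg]
    rfl

variable {K} {𝒳 : Scheme.{u}} {π : 𝒳 ⟶ Spec (.of (𝓞 K))} {E H : 𝒳.Modules} {s m : ℕ}
  {P : Fin s → (Spec (.of (𝓞 K)) ⟶ 𝒳)} (F : ∀ j, FormalFrame π E H (P j) m)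
  (hH : IsVectorBundle H 1) (f : Fin s → Fin m → K⟦X⟧)

/-- The map `⟨·; f⟩_n` from `G_x` to the sections of `H^{⊗ x}` over the `n`-th infinitesimal
neighbourhoods of the points `p_1, …, p_s`. -/
def jetMap (x n : ℕ) : TwistedSections π E H x →ₗ[𝓞 K] (Fin s → Jet K n) where
  toFun t j := Jet.mk n (pairing (F j) hH (f j) x t)
  map_add' t t' := funext fun j => by
    rw [Pi.add_apply, map_add, map_add]
  map_smul' r t := funext fun j => by
    rw [Pi.smul_apply, RingHom.id_apply, pairing_smul, Jet.smul_mk]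

/-- The submodule `G_x^i` of `G_x`, the kernel of `⟨·; f⟩_i`. -/
def fil (x i : ℕ) : Submodule (𝓞 K) (TwistedSections π E H x) :=
  LinearMap.ker (jetMap F hH f x i)

/-- The module `G_x^i / G_x^{i+1}`. -/
abbrev Gr (x i : ℕ) : Type u := fil F hH f x i ⧸ (fil F hH f x (i + 1)).submoduleOf (fil F hH f x i)

lemma jetRestrict_jetMap (x i : ℕ) (t : TwistedSections π E H x) :
    jetRestrict K s i (jetMap F hH f x (i + 1) t) = jetMap F hH f x i t := rfl

/-- The map `γ_x^i : G_x^i / G_x^{i+1} → ⊕ⱼ H⁰(p_j, H^{⊗ x} ⊗ T^{⊗ -i}) ⊗ K` induced by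
`⟨·; f⟩_{i+1}`. -/
def gamma (x i : ℕ) : Gr F hH f x i →ₗ[𝓞 K] LeadingTerms K s i :=
  Submodule.liftQ _
    (LinearMap.codRestrict (LeadingTerms K s i)
      (jetMap F hH f x (i + 1) ∘ₗ (fil F hH f x i).subtype)
      (fun t => LinearMap.mem_ker.mpr
        ((jetRestrict_jetMap F hH f x i t.1).trans (LinearMap.mem_ker.mp t.2))))
    (fun _ ht => LinearMap.mem_ker.mpr (Subtype.ext (LinearMap.mem_ker.mp
      (Submodule.mem_comap.mp ht))))

lemma gamma_injective (x i : ℕ) : Function.Injective (gamma F hH f x i) := by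
  rw [← LinearMap.ker_eq_bot, gamma, Submodule.ker_liftQ_eq_bot]
  intro t ht
  exact Submodule.mem_comap.mpr (LinearMap.mem_ker.mpr
    (congrArg Subtype.val (LinearMap.mem_ker.mp ht)))

end Filtration

/-! ### Norms at the finite places -/

section Norms

variable {K : Type u} [Field K] [NumberField K] (v : HeightOneSpectrum (𝓞 K))
  {M N : Type u} [AddCommGroup M] [Module (𝓞 K) M] [AddCommGroup N] [Module (𝓞 K) N]

/-- The `O_v`-submodule `L_{O_v}` of `M_v = K_v ⊗ M` generated by a submodule `L` of `M`. -/
def localLattice (L : Submodule (𝓞 K) M) :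
    Submodule (v.adicCompletionIntegers K) (v.adicCompletion K ⊗[𝓞 K] M) :=
  Submodule.span _ ((fun w : M => (1 : v.adicCompletion K) ⊗ₜ[𝓞 K] w) '' L)

/-- The norm on `M_v = K_v ⊗ M` that is induced by the integral structure `L ⊆ M`, whose unit ball
is `L_{O_v}`. The norm on `K_v` is the normalized one, with `‖a‖ = #(𝓞 K / v) ^ (-v(a))`. -/
def latticeNorm (L : Submodule (𝓞 K) M) (w : v.adicCompletion K ⊗[𝓞 K] M) : ℝ :=
  sInf {r | ∃ a : v.adicCompletion K, r = ‖a‖ ∧ ∃ w₀ ∈ localLattice v L, w = a • w₀}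

/-- The operator norm at `v` of an `𝓞 K`-linear map `g : M → N` for the integral structures
`L ⊆ M` and `L' ⊆ N`. -/
def opNormAt (L : Submodule (𝓞 K) M) (L' : Submodule (𝓞 K) N) (g : M →ₗ[𝓞 K] N) : ℝ :=
  sInf {c | 0 ≤ c ∧ ∀ w : v.adicCompletion K ⊗[𝓞 K] M,
    latticeNorm v L' (g.baseChange (v.adicCompletion K) w) ≤ c * latticeNorm v L w}

end Norms

/-! ### `LG`-germs -/

section Germs

variable {K : Type u} [Field K] [NumberField K]

/-- A power series has positive radius of convergence for the absolute value `w`. -/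
def PositiveRadius (w : K → ℝ) (a : K⟦X⟧) : Prop :=
  ∃ r : ℝ, 0 < r ∧ BddAbove (Set.range fun i : ℕ => w (coeff i a) * r ^ i)

/-- `f ∈ K⟦Z⟧ ^ m` is an `LG`-germ of type `α`. The absolute values at the finite places are the
normalized ones. The finite set of exceptional places may always be enlarged, and it is understood
to contain the infinite places; `S` is the set of finite exceptional places. The last condition
says that the product of the `C_v` over `v ∉ S` is finite. -/
def IsLGGerm (α : ℝ) {m : ℕ} (f : Fin m → K⟦X⟧) : Prop :=
  (∀ k, (∀ v : HeightOneSpectrum (𝓞 K), PositiveRadius (HeightOneSpectrum.adicAbv K v) (f k)) ∧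
    ∀ w : InfinitePlace K, PositiveRadius w (f k)) ∧
  ∃ (S : Finset (HeightOneSpectrum (𝓞 K))) (Cv : HeightOneSpectrum (𝓞 K) → ℝ),
    (∀ v ∉ S, 0 < Cv v ∧ ∀ (k : Fin m) (i : ℕ),
      HeightOneSpectrum.adicAbv K v (coeff i (f k)) ≤
        Cv v ^ i / HeightOneSpectrum.adicAbv K v (i.factorial : K) ^ α) ∧
    BddAbove (Set.range fun T : Finset {v : HeightOneSpectrum (𝓞 K) // v ∉ S} =>
      ∏ v ∈ T, Cv v.1)

end Germs

end LGGerms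

end

/-! A jet that vanishes to order `i` at each point is determined by its coefficients of `Z ^ i`, so
`γ_x^i` is a finite family of `K`-valued linear forms: the `i`-th coefficients of the series `⟨t;
f_j⟩`. The integral structure is the one where these coefficients lie in `𝓞 K`. Hence `‖γ_x^i‖_v`
lies between the `v`-adic absolute value of any single coefficient and any common upper bound for
all of them (`IsIntegralBasis.le_opNormAt`, `IsIntegralBasis.opNormAt_le`).

Upper bound. A global section `t` of `E ⊗ H^{⊗ x}` is regular at the closed point of `P_j` over `v`,
so its coordinates along `P_j` are power series with `v`-integral coefficients, for every finite `v`
and every `x` (`isIntegralAt_pairing_single`). By the ultrametric inequality the `i`-th coefficient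
of `⟨t; f_j⟩` is then at most the largest coefficient of `f_j` of order at most `i`. The
LG-condition bounds this by `exp (b_v (i + 1)) / |i!|_v ^ α` with `∑ b_v` finite; positive radius of
convergence supplies the finitely many exceptional places (`IsLGGerm.exists_summable_bound`). The
product formula for `i!` and `i! ≤ i ^ i` turn the denominators into `[K : ℚ] α i log i`.

Positivity and convergence. If `γ_x^i ≠ 0`, some value has a coordinate `c ≠ 0` in `K`, and `|c|_v ≤
‖γ_x^i‖_v` for all `v`. Since `log |c|_v` vanishes for almost all `v`, the logarithms of the norms
are squeezed between two summable families. -/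

namespace LGGerms

/-! ### Integrality at `v` of the expansions of global sections -/

section Integrality

/-- The restriction of an element of `R` to an open subset of `Spec R`. -/
noncomputable def toSections (R : CommRingCat.{u}) (V : (Spec R).Opens) : R →+* Γ(Spec R, V) :=
  ((Scheme.ΓSpecIso R).inv ≫ (Spec R).presheaf.map (homOfLE le_top).op).hom

/-- A section of the structure sheaf of `Spec R` is a fraction in a neighbourhood of each point. -/
lemma exists_fraction {R : CommRingCat.{u}} (V : (Spec R).Opens) (y : PrimeSpectrum R) (hy : y ∈ V)
    (g : Γ(Spec R, V)) : ∃ (a b : R) (W : (Spec R).Opens) (hW : W ≤ V), b ∉ y.asIdeal ∧ y ∈ W ∧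
      toSections R W b * (Spec R).presheaf.map (homOfLE hW).op g = toSections R W a := by
  obtain ⟨_, ⟨b, rfl⟩, hyb, hbV⟩ :=
    PrimeSpectrum.isTopologicalBasis_basic_opens.exists_subset_of_mem_open hy V.isOpen
  let W : (Spec R).Opens := PrimeSpectrum.basicOpen b
  have hW : W ≤ V := hbV
  have hloc : IsLocalization.Away b Γ(Spec R, W) :=
    StructureSheaf.IsLocalization.to_basicOpen R b
  obtain ⟨⟨a, ⟨_, n, rfl⟩⟩, h⟩ := IsLocalization.surj (M := .powers b)
    ((Spec R).presheaf.map (homOfLE hW).op g)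
  exact ⟨a, b ^ n, W, hW, fun hb => hyb (y.isPrime.mem_of_pow_mem n hb), hyb,
    (mul_comm _ _).trans h⟩

variable {K : Type u} [Field K]

/-- The power series over `K` that a function on a neighbourhood of the generic point of `Z = 0`
in `Spec 𝓞 K⟦Z⟧` induces. -/
noncomputable def toSeries (V : (Spec (.of (𝓞 K)⟦X⟧)).Opens)
    (hV : genericMap K (IsLocalRing.closedPoint K⟦X⟧) ∈ V) :
    Γ(Spec (.of (𝓞 K)⟦X⟧), V) →+* K⟦X⟧ :=
  ((Spec (.of (𝓞 K)⟦X⟧)).presheaf.germ V (genericMap K (IsLocalRing.closedPoint K⟦X⟧)) hV ≫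
    Scheme.stalkClosedPointTo (R := .of K⟦X⟧) (genericMap K)).hom

lemma toSeries_res {V W : (Spec (.of (𝓞 K)⟦X⟧)).Opens} (hW : W ≤ V)
    (hg : genericMap K (IsLocalRing.closedPoint K⟦X⟧) ∈ W) (g : Γ(Spec (.of (𝓞 K)⟦X⟧), V)) :
    toSeries W hg ((Spec (.of (𝓞 K)⟦X⟧)).presheaf.map (homOfLE hW).op g) =
      toSeries V (hW hg) g := by
  have h := TopCat.Presheaf.germ_res (Spec (.of (𝓞 K)⟦X⟧)).presheaf (homOfLE hW)
    (genericMap K (IsLocalRing.closedPoint K⟦X⟧)) hg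
  exact congr((Scheme.stalkClosedPointTo (R := .of K⟦X⟧) (genericMap K)).hom ($h g))

lemma toSeries_toSections (V : (Spec (.of (𝓞 K)⟦X⟧)).Opens)
    (hV : genericMap K (IsLocalRing.closedPoint K⟦X⟧) ∈ V) (a : (𝓞 K)⟦X⟧) :
    toSeries V hV (toSections (.of (𝓞 K)⟦X⟧) V a) =
      PowerSeries.map (algebraMap (𝓞 K) K) a := by
  have h2 : (Spec (.of (𝓞 K)⟦X⟧)).presheaf.germ ⊤
      (genericMap K (IsLocalRing.closedPoint K⟦X⟧)) trivial ≫
        Scheme.stalkClosedPointTo (R := .of K⟦X⟧) (genericMap K) =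
      (Scheme.ΓSpecIso (.of (𝓞 K)⟦X⟧)).hom ≫
        CommRingCat.ofHom (PowerSeries.map (algebraMap (𝓞 K) K)) :=
    Scheme.germ_stalkClosedPointTo_Spec _
  refine (toSeries_res le_top hV ((Scheme.ΓSpecIso (.of (𝓞 K)⟦X⟧)).inv a)).trans ?_
  refine (congr($(h2) ((Scheme.ΓSpecIso (.of (𝓞 K)⟦X⟧)).inv a))).trans ?_
  have h3 : (Scheme.ΓSpecIso (.of (𝓞 K)⟦X⟧)).inv ≫ (Scheme.ΓSpecIso (.of (𝓞 K)⟦X⟧)).hom ≫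
      CommRingCat.ofHom (PowerSeries.map (algebraMap (𝓞 K) K)) =
      CommRingCat.ofHom (PowerSeries.map (algebraMap (𝓞 K) K)) := Iso.inv_hom_id_assoc _ _
  exact congr($(h3) a)

variable {𝒳 : Scheme.{u}} {π : 𝒳 ⟶ Spec (.of (𝓞 K))} {E H : 𝒳.Modules}
  {P : Spec (.of (𝓞 K)) ⟶ 𝒳} {m : ℕ}

/-- Separates the contribution of the section, which will be integral, from that of the germ:
pairing with the `k`-th unit vector extracts the `k`-th coordinate of `t`, with the power of the
generator of `H` included. -/
lemma pairing_eq_sum (F : FormalFrame π E H P m) (hH : IsVectorBundle H 1) (f : Fin m → K⟦X⟧)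
    (x : ℕ) (t : TwistedSections π E H x) :
    pairing F hH f x t = ∑ k, pairing F hH (Pi.single k 1) x t * f k := by
  change (∑ k, _ * f k) * _ = ∑ k, ((∑ l, _ * (Pi.single k 1 : Fin m → K⟦X⟧) l) * _) * f k
  rw [Finset.sum_mul]
  refine Finset.sum_congr rfl fun k _ => ?_
  rw [Finset.sum_eq_single k (fun l _ hl => by rw [Pi.single_eq_of_ne hl, mul_zero])
    (fun h => absurd (Finset.mem_univ k) h), Pi.single_eq_same, mul_one]
  ring

variable (v : HeightOneSpectrum (𝓞 K))

/-- The closed point of `Spec 𝓞 K⟦Z⟧` over `v` that lies on `Z = 0`. -/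
noncomputable def placePoint : Spec (.of (𝓞 K)⟦X⟧) :=
  PrimeSpectrum.comap (constantCoeff (R := 𝓞 K)) ⟨v.asIdeal, v.isPrime⟩

/-- The generic point of `Z = 0` specializes to its closed point over `v`: a series that becomes a
non-unit in `K⟦Z⟧` has constant coefficient zero. Functions near the closed point can therefore be
expanded in `K⟦Z⟧`. -/
lemma genericPoint_mem_of_placePoint_mem {V : (Spec (.of (𝓞 K)⟦X⟧)).Opens}
    (hV : placePoint v ∈ V) : genericMap K (IsLocalRing.closedPoint K⟦X⟧) ∈ V := by
  have h : genericMap K (IsLocalRing.closedPoint K⟦X⟧) ⤳ placePoint v := by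
    refine (PrimeSpectrum.le_iff_specializes
      (PrimeSpectrum.comap (PowerSeries.map (algebraMap (𝓞 K) K))
        (IsLocalRing.closedPoint K⟦X⟧))
      (PrimeSpectrum.comap (constantCoeff (R := 𝓞 K)) ⟨v.asIdeal, v.isPrime⟩)).mp ?_
    intro a ha
    change PowerSeries.map (algebraMap (𝓞 K) K) a ∈ IsLocalRing.maximalIdeal K⟦X⟧ at ha
    change constantCoeff a ∈ v.asIdeal
    rw [IsLocalRing.mem_maximalIdeal, mem_nonunits_iff, isUnit_iff_constantCoeff,
      isUnit_iff_ne_zero, not_not, ← coeff_zero_eq_constantCoeff_apply, coeff_map,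
      map_eq_zero_iff _ (FaithfulSMul.algebraMap_injective (𝓞 K) K)] at ha
    rw [← coeff_zero_eq_constantCoeff_apply, ha]
    exact zero_mem _
  exact h.mem_open V.isOpen hV

variable [NumberField K]

lemma adicAbv_algebraMap_le_one (r : 𝓞 K) :
    HeightOneSpectrum.adicAbv K v (algebraMap (𝓞 K) K r) ≤ 1 :=
  v.adicAbv_coe_le_one (HeightOneSpectrum.one_lt_absNorm_nnreal v) r

/-- The coefficients of the power series are `v`-integral. -/
def IsIntegralAt (a : K⟦X⟧) : Prop :=
  ∀ n, HeightOneSpectrum.adicAbv K v (coeff n a) ≤ 1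

lemma adicAbv_sum_le {ι : Type*} (t : Finset ι) (a : ι → K) {B : ℝ} (hB : 0 ≤ B)
    (h : ∀ l ∈ t, HeightOneSpectrum.adicAbv K v (a l) ≤ B) :
    HeightOneSpectrum.adicAbv K v (∑ l ∈ t, a l) ≤ B := by
  classical
  induction t using Finset.induction_on with
  | empty => simpa using hB
  | insert l t hl ih =>
    rw [Finset.sum_insert hl]
    refine (HeightOneSpectrum.adicAbv_add_le_max K v _ _).trans (max_le ?_ ?_)
    · exact h l (Finset.mem_insert_self _ _)
    · exact ih fun k hk => h k (Finset.mem_insert_of_mem hk)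

variable {v} in
-- Only the coefficients of `b` up to order `n` enter. This matters because `b` will be a germ,
-- whose coefficients need not be bounded as a whole.
lemma IsIntegralAt.adicAbv_coeff_mul_le {a b : K⟦X⟧} (ha : IsIntegralAt v a) {n : ℕ} {B : ℝ}
    (hB : 0 ≤ B) (hb : ∀ l ≤ n, HeightOneSpectrum.adicAbv K v (coeff l b) ≤ B) :
    HeightOneSpectrum.adicAbv K v (coeff n (a * b)) ≤ B := by
  rw [coeff_mul]
  refine adicAbv_sum_le v _ _ hB fun p hp => ?_
  rw [map_mul]
  have := hb p.2 (Finset.HasAntidiagonal.antidiagonal.snd_le hp)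
  nlinarith [ha p.1, (HeightOneSpectrum.adicAbv K v).nonneg (coeff p.1 a),
    (HeightOneSpectrum.adicAbv K v).nonneg (coeff p.2 b)]

variable {v} in
lemma IsIntegralAt.mul {a b : K⟦X⟧} (ha : IsIntegralAt v a) (hb : IsIntegralAt v b) :
    IsIntegralAt v (a * b) :=
  fun _ => ha.adicAbv_coeff_mul_le zero_le_one fun l _ => hb l

variable {v} in
lemma IsIntegralAt.pow {a : K⟦X⟧} (ha : IsIntegralAt v a) (x : ℕ) : IsIntegralAt v (a ^ x) := by
  induction x with
  | zero =>
    intro n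
    rw [pow_zero, coeff_one]
    split_ifs <;> simp
  | succ x ih => rw [pow_succ]; exact ih.mul ha

lemma isIntegralAt_map (a : (𝓞 K)⟦X⟧) :
    IsIntegralAt v (PowerSeries.map (algebraMap (𝓞 K) K) a) := fun n => by
  rw [coeff_map]
  exact adicAbv_algebraMap_le_one v _

variable {v} in
/-- Division by a power series with integral coefficients whose constant coefficient is a unit
preserves integrality. -/
lemma IsIntegralAt.of_mul_left {b g : K⟦X⟧} (hb : IsIntegralAt v b)
    (hb0 : HeightOneSpectrum.adicAbv K v (constantCoeff b) = 1) (h : IsIntegralAt v (b * g)) :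
    IsIntegralAt v g := by
  intro n
  induction n using Nat.strong_induction_on with
  | _ n ih =>
    -- The `n`-th coefficient of `b * g`, solved for the term containing `coeff n g`. The remaining
    -- terms involve only earlier coefficients of `g`, which are integral by induction.
    have h1 : constantCoeff b * coeff n g =
        coeff n (b * g) + -∑ p ∈ (Finset.HasAntidiagonal.antidiagonal n).erase (0, n),
          coeff p.1 b * coeff p.2 g := by
      rw [coeff_mul, ← Finset.add_sum_erase _ _
        (show (0, n) ∈ Finset.HasAntidiagonal.antidiagonal n by simp)]
      simp
    have h2 : HeightOneSpectrum.adicAbv K v (constantCoeff b * coeff n g) ≤ 1 := by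
      rw [h1]
      refine (HeightOneSpectrum.adicAbv_add_le_max K v _ _).trans (max_le (h n) ?_)
      rw [map_neg_eq_map]
      refine adicAbv_sum_le v _ _ zero_le_one fun p hp => ?_
      obtain ⟨hp1, hp2⟩ := Finset.mem_erase.mp hp
      have hp3 := Finset.HasAntidiagonal.mem_antidiagonal.mp hp2
      have hlt : p.2 < n := by
        refine lt_of_le_of_ne (by omega) fun hpn => hp1 (Prod.ext ?_ hpn)
        change p.1 = 0
        omega
      rw [map_mul]
      exact mul_le_one₀ (hb p.1) ((HeightOneSpectrum.adicAbv K v).nonneg _) (ih _ hlt)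
    rwa [map_mul, hb0, one_mul] at h2

/-- Near the closed point over `v` the function is a fraction `a / b` of series over `𝓞 K`. That `b`
does not vanish there means that its constant coefficient is a `v`-unit, so dividing by `b`
preserves integrality. -/
lemma isIntegralAt_toSeries (V : (Spec (.of (𝓞 K)⟦X⟧)).Opens) (hV : placePoint v ∈ V)
    (g : Γ(Spec (.of (𝓞 K)⟦X⟧), V)) :
    IsIntegralAt v (toSeries V (genericPoint_mem_of_placePoint_mem v hV) g) := by
  obtain ⟨a, b, W, hW, hb, hyW, h⟩ := exists_fraction V (placePoint v) hV g
  have hgW := genericPoint_mem_of_placePoint_mem v hyW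
  have h1 := congrArg (toSeries W hgW) h
  rw [map_mul, toSeries_res] at h1
  have h2 : PowerSeries.map (algebraMap (𝓞 K) K) b * toSeries V (hW hgW) g =
      PowerSeries.map (algebraMap (𝓞 K) K) a :=
    (congrArg (· * _) (toSeries_toSections W hgW b)).symm.trans
      (h1.trans (toSeries_toSections W hgW a))
  refine (isIntegralAt_map v b).of_mul_left ?_ (h2 ▸ isIntegralAt_map v a)
  rw [← coeff_zero_eq_constantCoeff_apply, coeff_map, coeff_zero_eq_constantCoeff_apply]
  exact (v.adicAbv_coe_eq_one_iff (HeightOneSpectrum.one_lt_absNorm_nnreal v) _).mpr hb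

lemma isIntegralAt_expandSection (c : FormalChart π P) (τ : Trivialization E c.map m) (k : Fin m)
    (U : 𝒳.Opens) (hv : c.map (placePoint v) ∈ U) (hU : c.point ∈ U) (t : Γ(E, U)) :
    IsIntegralAt v (c.expandSection τ k U hU t) :=
  isIntegralAt_toSeries v (c.map ⁻¹ᵁ U) hv (functionOf (τ.coord k) U t)

lemma isIntegralAt_pairing_single (F : FormalFrame π E H P m) (hH : IsVectorBundle H 1)
    (x : ℕ) (t : TwistedSections π E H x) (k : Fin m) :
    IsIntegralAt v (pairing F hH (Pi.single k 1) x t) := by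
  -- The neighbourhood chosen in the definition of `pairing` need not contain the closed point over
  -- `v`. One adapted to `v` is used instead, which `pairing_eq` permits.
  obtain ⟨U, hU, e, he⟩ := hH (F.chart.map (placePoint v))
  have hp : F.chart.point ∈ U := genericPoint_mem_of_placePoint_mem v (V := F.chart.map ⁻¹ᵁ U) hU
  have he0 : (fun _ : Fin 1 => e 0) = e := funext fun k => congrArg e (Subsingleton.elim 0 k)
  rw [pairing_eq F hH (Pi.single k 1) x t U hp ⟨e 0, he0.symm ▸ he⟩,
    Finset.sum_eq_single k (fun l _ hl => by rw [Pi.single_eq_of_ne hl, mul_zero])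
    (fun h => absurd (Finset.mem_univ k) h), Pi.single_eq_same, mul_one]
  exact (isIntegralAt_expandSection v _ _ _ _ hU _ _).mul
    ((isIntegralAt_expandSection v _ _ _ _ hU _ _).pow x)

/-- The coefficients of `⟨t; f⟩` are bounded at `v` by those of `f`. -/
lemma adicAbv_coeff_pairing_le (F : FormalFrame π E H P m) (hH : IsVectorBundle H 1)
    (f : Fin m → K⟦X⟧) (x : ℕ) (t : TwistedSections π E H x) {n : ℕ} {B : ℝ} (hB : 0 ≤ B)
    (hf : ∀ k, ∀ l ≤ n, HeightOneSpectrum.adicAbv K v (coeff l (f k)) ≤ B) :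
    HeightOneSpectrum.adicAbv K v (coeff n (pairing F hH f x t)) ≤ B := by
  rw [pairing_eq_sum, map_sum]
  exact adicAbv_sum_le v _ _ hB fun k _ =>
    (isIntegralAt_pairing_single v F hH x t k).adicAbv_coeff_mul_le hB (hf k)

end Integrality

/-! ### Lattice norms and operator norms in coordinates -/

section LatticeNorms

variable {K : Type u} [Field K] [NumberField K] (v : HeightOneSpectrum (𝓞 K))
  {M N : Type u} [AddCommGroup M] [Module (𝓞 K) M] [AddCommGroup N] [Module (𝓞 K) N]

lemma mem_adicCompletionIntegers_iff_norm_le_one (a : v.adicCompletion K) :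
    a ∈ v.adicCompletionIntegers K ↔ ‖a‖ ≤ 1 := by
  rw [HeightOneSpectrum.mem_adicCompletionIntegers, FinitePlace.norm_def]
  exact_mod_cast (WithZeroMulInt.toNNReal_le_one_iff
    (HeightOneSpectrum.one_lt_absNorm_nnreal v)).symm

lemma norm_algebraMap_adicCompletion (a : K) :
    ‖algebraMap K (v.adicCompletion K) a‖ = HeightOneSpectrum.adicAbv K v a :=
  FinitePlace.norm_embedding v a

lemma latticeNorm_le {L : Submodule (𝓞 K) M} {w : v.adicCompletion K ⊗[𝓞 K] M}
    (a : v.adicCompletion K) {w₀ : v.adicCompletion K ⊗[𝓞 K] M} (hw₀ : w₀ ∈ localLattice v L)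
    (hw : w = a • w₀) : latticeNorm v L w ≤ ‖a‖ :=
  csInf_le ⟨0, by rintro _ ⟨a, rfl, -⟩; exact norm_nonneg a⟩ ⟨a, rfl, w₀, hw₀, hw⟩

lemma smul_mem_localLattice {L : Submodule (𝓞 K) M} {w : v.adicCompletion K ⊗[𝓞 K] M}
    (hw : w ∈ localLattice v L) {a : v.adicCompletion K} (ha : ‖a‖ ≤ 1) :
    a • w ∈ localLattice v L := by
  have h := (localLattice v L).smul_mem
    ⟨a, (mem_adicCompletionIntegers_iff_norm_le_one v a).mpr ha⟩ hw
  rwa [← smul_one_smul (v.adicCompletion K)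
    (⟨a, (mem_adicCompletionIntegers_iff_norm_le_one v a).mpr ha⟩ : v.adicCompletionIntegers K) w,
    show (⟨a, (mem_adicCompletionIntegers_iff_norm_le_one v a).mpr ha⟩ :
      v.adicCompletionIntegers K) • (1 : v.adicCompletion K) = a from mul_one a] at h

/-- Finitely many multiples of elements of the lattice lie in one multiple of the lattice. -/
lemma exists_smul_of_sum {ι : Type*} (t : Finset ι) {L : Submodule (𝓞 K) M}
    (a : ι → v.adicCompletion K) (w : ι → v.adicCompletion K ⊗[𝓞 K] M)
    (hw : ∀ j ∈ t, w j ∈ localLattice v L) {B : ℝ} (hB : 0 ≤ B) (ha : ∀ j ∈ t, ‖a j‖ ≤ B) :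
    ∃ b : v.adicCompletion K, ‖b‖ ≤ B ∧ ∃ w₀ ∈ localLattice v L, ∑ j ∈ t, a j • w j = b • w₀ := by
  rcases t.eq_empty_or_nonempty with rfl | ht
  · exact ⟨0, by simpa using hB, 0, zero_mem _, by simp⟩
  -- The common factor is a coefficient of largest norm: all quotients by it are then `v`-integral.
  -- If it is zero, the whole sum vanishes.
  obtain ⟨k, hk, hmax⟩ := t.exists_max_image (fun j => ‖a j‖) ht
  rcases eq_or_ne (a k) 0 with h0 | h0
  · refine ⟨0, by simpa using hB, 0, zero_mem _, ?_⟩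
    rw [smul_zero]
    refine Finset.sum_eq_zero fun j hj => ?_
    have h1 := hmax j hj
    rw [h0, norm_zero] at h1
    rw [norm_le_zero_iff.mp h1, zero_smul]
  · refine ⟨a k, ha k hk, ∑ j ∈ t, (a j / a k) • w j, ?_, ?_⟩
    · refine sum_mem fun j hj => smul_mem_localLattice v (hw j hj) ?_
      rw [norm_div]
      exact div_le_one_of_le₀ (hmax j hj) (norm_nonneg _)
    · rw [Finset.smul_sum]
      refine Finset.sum_congr rfl fun j _ => ?_
      rw [smul_smul, mul_div_cancel₀ _ h0]

/-- Guarantees that the infimum in `latticeNorm v ⊤ w` is over a nonempty set, so that it is not the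
default value `0`. -/
lemma exists_smul_localLattice_top (w : v.adicCompletion K ⊗[𝓞 K] M) :
    ∃ a : v.adicCompletion K, ∃ w₀ ∈ localLattice v (⊤ : Submodule (𝓞 K) M), w = a • w₀ := by
  obtain ⟨t, rfl⟩ := TensorProduct.exists_finset w
  obtain ⟨b, -, h⟩ := exists_smul_of_sum v t (L := (⊤ : Submodule (𝓞 K) M)) (fun p => p.1)
    (fun p => 1 ⊗ₜ p.2) (fun p _ => Submodule.subset_span ⟨p.2, trivial, rfl⟩)
    (B := ∑ p ∈ t, ‖p.1‖) (Finset.sum_nonneg fun _ _ => norm_nonneg _)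
    (fun p hp => Finset.single_le_sum (f := fun p => ‖p.1‖) (fun _ _ => norm_nonneg _) hp)
  refine ⟨b, ?_⟩
  simpa only [TensorProduct.smul_tmul', smul_eq_mul, mul_one] using h

/-- The extension to `K_v ⊗ N` of a linear form on `N`. -/
noncomputable def extendForm (φ : N →ₗ[𝓞 K] K) :
    v.adicCompletion K ⊗[𝓞 K] N →ₗ[v.adicCompletion K] v.adicCompletion K :=
  LinearMap.liftBaseChange (v.adicCompletion K)
    (((Algebra.linearMap K (v.adicCompletion K)).restrictScalars (𝓞 K)) ∘ₗ φ)

lemma extendForm_tmul (φ : N →ₗ[𝓞 K] K) (a : v.adicCompletion K) (y : N) :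
    extendForm v φ (a ⊗ₜ y) = a * algebraMap K (v.adicCompletion K) (φ y) := by
  simp [extendForm]

/-- A linear form that is bounded on a lattice is bounded on the local lattice. -/
lemma norm_extendForm_le (φ : N →ₗ[𝓞 K] K) {L : Submodule (𝓞 K) N} {B : ℝ} (hB : 0 ≤ B)
    (hφ : ∀ y ∈ L, HeightOneSpectrum.adicAbv K v (φ y) ≤ B)
    {w : v.adicCompletion K ⊗[𝓞 K] N} (hw : w ∈ localLattice v L) : ‖extendForm v φ w‖ ≤ B := by
  induction hw using Submodule.span_induction with
  | mem w hw =>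
    obtain ⟨y, hy, rfl⟩ := hw
    dsimp only
    rw [extendForm_tmul, one_mul, norm_algebraMap_adicCompletion]
    exact hφ y hy
  | zero => simpa using hB
  | add w w' _ _ h h' =>
    rw [map_add]
    exact (IsUltrametricDist.norm_add_le_max _ _).trans (max_le h h')
  | smul a w _ h =>
    rw [← smul_one_smul (v.adicCompletion K) a w, map_smul, smul_eq_mul, norm_mul]
    have h1 : ‖a • (1 : v.adicCompletion K)‖ ≤ 1 := by
      rw [show a • (1 : v.adicCompletion K) = a from mul_one _]
      exact (mem_adicCompletionIntegers_iff_norm_le_one v _).mp a.2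
    nlinarith [norm_nonneg (extendForm v φ w)]

/-- If every linear form of a family is integral on `L`, the lattice norm dominates the family. -/
lemma adicAbv_le_latticeNorm (φ : N →ₗ[𝓞 K] K) {L : Submodule (𝓞 K) N}
    (hφ : ∀ y ∈ L, HeightOneSpectrum.adicAbv K v (φ y) ≤ 1) (y : N)
    (hy : ∃ a : v.adicCompletion K, ∃ w₀ ∈ localLattice v L, 1 ⊗ₜ y = a • w₀) :
    HeightOneSpectrum.adicAbv K v (φ y) ≤ latticeNorm v L (1 ⊗ₜ y) := by
  obtain ⟨a, w₀, hw₀, h⟩ := hy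
  refine le_csInf ⟨‖a‖, a, rfl, w₀, hw₀, h⟩ ?_
  rintro _ ⟨b, rfl, w, hw, h'⟩
  have h1 := congrArg (fun z => ‖extendForm v φ z‖) h'
  rw [extendForm_tmul, one_mul, norm_algebraMap_adicCompletion, map_smul, smul_eq_mul,
    norm_mul] at h1
  rw [h1]
  exact mul_le_of_le_one_right (norm_nonneg _) (norm_extendForm_le v φ zero_le_one hφ hw)

/-- `e` is a family in the lattice `L` and `φ` the dual family of linear forms: `φ` separates the
points of `N` and is integral on `L`. -/
structure IsIntegralBasis {ι : Type*} [DecidableEq ι] (L : Submodule (𝓞 K) N) (e : ι → N)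
    (φ : ι → N →ₗ[𝓞 K] K) : Prop where
  mem (j : ι) : e j ∈ L
  form_apply (j k : ι) : φ j (e k) = if j = k then 1 else 0
  eq_zero (y : N) : (∀ j, φ j y = 0) → y = 0
  integral (j : ι) (y : N) : y ∈ L → φ j y ∈ Set.range (algebraMap (𝓞 K) K)

variable {ι : Type*} [Fintype ι] [DecidableEq ι] {L : Submodule (𝓞 K) N} {e : ι → N}
  {φ : ι → N →ₗ[𝓞 K] K}

/-- Expansion in dual bases. On a pure tensor `a ⊗ y`, a common denominator `d` of the coordinates
of `y` makes `d • y` an `𝓞 K`-combination of the `e j`, because the forms separate points; `d` is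
then inverted in `K_v`. -/
lemma IsIntegralBasis.sum_extendForm (h : IsIntegralBasis L e φ)
    (w : v.adicCompletion K ⊗[𝓞 K] N) :
    w = ∑ j, extendForm v (φ j) w • ((1 : v.adicCompletion K) ⊗ₜ[𝓞 K] e j) := by
  induction w using TensorProduct.induction_on with
  | zero => simp
  | add w w' hw hw' =>
    simp only [map_add, add_smul, Finset.sum_add_distrib]
    rw [← hw, ← hw']
  | tmul a y =>
    classical
    obtain ⟨d, hd⟩ := IsLocalization.exist_integer_multiples_of_finset
      (nonZeroDivisors (𝓞 K)) (Finset.univ.image fun j => φ j y)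
    choose r hr using fun j => hd (φ j y) (Finset.mem_image_of_mem _ (Finset.mem_univ j))
    have hdy : (d : 𝓞 K) • y = ∑ j, r j • e j := by
      rw [← sub_eq_zero]
      refine h.eq_zero _ fun k => ?_
      simp only [map_sub, map_smul, map_sum, h.form_apply, smul_ite, smul_zero,
        Finset.sum_ite_eq, Finset.mem_univ, if_true]
      rw [← hr k, Algebra.smul_def (r k), mul_one, sub_self]
    have hd0 : algebraMap K (v.adicCompletion K) (algebraMap (𝓞 K) K d) ≠ 0 := by
      rw [map_ne_zero, map_ne_zero_iff _ (FaithfulSMul.algebraMap_injective (𝓞 K) K)]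
      exact nonZeroDivisors.ne_zero d.2
    have hrj (j : ι) : algebraMap K (v.adicCompletion K) (algebraMap (𝓞 K) K (r j)) =
        algebraMap K (v.adicCompletion K) (algebraMap (𝓞 K) K d) *
          algebraMap K (v.adicCompletion K) (φ j y) := by
      rw [← map_mul, hr j, Algebra.smul_def]
    have h1 : a ⊗ₜ[𝓞 K] y =
        (a / algebraMap K (v.adicCompletion K) (algebraMap (𝓞 K) K d)) ⊗ₜ[𝓞 K] ((d : 𝓞 K) • y) := by
      rw [TensorProduct.tmul_smul, TensorProduct.smul_tmul', Algebra.smul_def,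
        IsScalarTower.algebraMap_apply (𝓞 K) K (v.adicCompletion K), mul_div_cancel₀ _ hd0]
    simp only [extendForm_tmul]
    rw [h1, hdy, TensorProduct.tmul_sum]
    refine Finset.sum_congr rfl fun j _ => ?_
    rw [TensorProduct.tmul_smul, TensorProduct.smul_tmul', TensorProduct.smul_tmul',
      Algebra.smul_def, IsScalarTower.algebraMap_apply (𝓞 K) K (v.adicCompletion K), hrj,
      smul_eq_mul, mul_one]
    congr 1
    field_simp

/-- Converts bounds on coordinates into bounds for the lattice norm, by factoring a largest
coordinate out of the dual basis expansion. -/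
lemma IsIntegralBasis.exists_smul (h : IsIntegralBasis L e φ)
    (w : v.adicCompletion K ⊗[𝓞 K] N) {B : ℝ} (hB : 0 ≤ B)
    (hw : ∀ j, ‖extendForm v (φ j) w‖ ≤ B) :
    ∃ b : v.adicCompletion K, ‖b‖ ≤ B ∧ ∃ w₀ ∈ localLattice v L, w = b • w₀ := by
  obtain ⟨b, hb, w₀, hw₀, hs⟩ := exists_smul_of_sum v Finset.univ (L := L)
    (fun j => extendForm v (φ j) w) (fun j => 1 ⊗ₜ e j)
    (fun j _ => Submodule.subset_span ⟨e j, h.mem j, rfl⟩) hB fun j _ => hw j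
  exact ⟨b, hb, w₀, hw₀, (h.sum_extendForm v w).trans hs⟩

lemma IsIntegralBasis.adicAbv_form_le_latticeNorm (h : IsIntegralBasis L e φ) (j : ι) (y : N) :
    HeightOneSpectrum.adicAbv K v (φ j y) ≤ latticeNorm v L (1 ⊗ₜ y) := by
  refine adicAbv_le_latticeNorm v (φ j) (fun y hy => ?_) y ?_
  · obtain ⟨r, hr⟩ := h.integral j y hy
    rw [← hr]
    exact adicAbv_algebraMap_le_one v r
  · obtain ⟨b, -, hb⟩ := h.exists_smul v (1 ⊗ₜ y)
      (B := ∑ j, ‖extendForm v (φ j) (1 ⊗ₜ y)‖) (Finset.sum_nonneg fun _ _ => norm_nonneg _)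
      (fun j => Finset.single_le_sum (f := fun j => ‖extendForm v (φ j) (1 ⊗ₜ y)‖)
        (fun _ _ => norm_nonneg _) (Finset.mem_univ j))
    exact ⟨b, hb⟩

lemma extendForm_baseChange (g : M →ₗ[𝓞 K] N) (φ : N →ₗ[𝓞 K] K)
    (w : v.adicCompletion K ⊗[𝓞 K] M) :
    extendForm v φ (g.baseChange (v.adicCompletion K) w) = extendForm v (φ ∘ₗ g) w := by
  induction w using TensorProduct.induction_on with
  | zero => simp
  | add w w' hw hw' => simp only [map_add, hw, hw']
  | tmul a y => simp only [LinearMap.baseChange_tmul, extendForm_tmul, LinearMap.comp_apply]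

/-- Bounds on the generators `1 ⊗ y` extend to the whole local lattice by the ultrametric
inequality. Homogeneity and the infimum over representations `w = a • w₀` do the rest. -/
lemma IsIntegralBasis.opNorm_bound (h : IsIntegralBasis L e φ) (g : M →ₗ[𝓞 K] N) {B : ℝ}
    (hB : 0 ≤ B) (hg : ∀ j y, HeightOneSpectrum.adicAbv K v (φ j (g y)) ≤ B)
    (w : v.adicCompletion K ⊗[𝓞 K] M) :
    latticeNorm v L (g.baseChange (v.adicCompletion K) w) ≤ B * latticeNorm v ⊤ w := by
  have key (a : v.adicCompletion K) (w₀ : v.adicCompletion K ⊗[𝓞 K] M)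
      (hw₀ : w₀ ∈ localLattice v (⊤ : Submodule (𝓞 K) M)) (hw : w = a • w₀) :
      latticeNorm v L (g.baseChange (v.adicCompletion K) w) ≤ B * ‖a‖ := by
    have h0 (j : ι) :
        ‖extendForm v (φ j) (g.baseChange (v.adicCompletion K) w₀)‖ ≤ B := by
      rw [extendForm_baseChange v g (φ j) w₀]
      exact norm_extendForm_le v (φ j ∘ₗ g) (L := ⊤) hB (fun y _ => hg j y) hw₀
    obtain ⟨b, hb, w₁, hw₁, h1⟩ := h.exists_smul v (g.baseChange (v.adicCompletion K) w₀) hB h0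
    refine (latticeNorm_le v (a * b) hw₁ ?_).trans ?_
    · rw [hw, map_smul, h1, smul_smul]
    · rw [norm_mul, mul_comm]
      exact mul_le_mul_of_nonneg_right hb (norm_nonneg a)
  obtain ⟨a, w₀, hw₀, hw⟩ := exists_smul_localLattice_top v w
  -- The infimum is reached by dividing by `B`. For `B = 0` a single representation of `w` already
  -- gives the claim.
  rcases hB.eq_or_lt with rfl | hB
  · simpa using key a w₀ hw₀ hw
  · rw [← div_le_iff₀' hB]
    refine le_csInf ⟨‖a‖, a, rfl, w₀, hw₀, hw⟩ ?_
    rintro _ ⟨b, rfl, w₁, hw₁, hb⟩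
    rw [div_le_iff₀' hB]
    exact key b w₁ hw₁ hb

/-- The operator norm is at most the supremum of the coordinates of the values. -/
lemma IsIntegralBasis.opNormAt_le (h : IsIntegralBasis L e φ) (g : M →ₗ[𝓞 K] N) {B : ℝ}
    (hB : 0 ≤ B) (hg : ∀ j y, HeightOneSpectrum.adicAbv K v (φ j (g y)) ≤ B) :
    opNormAt v ⊤ L g ≤ B :=
  csInf_le ⟨0, fun _ hc => hc.1⟩ ⟨hB, h.opNorm_bound v g hB hg⟩

/-- The operator norm is at least every coordinate of a value. -/
lemma IsIntegralBasis.le_opNormAt (h : IsIntegralBasis L e φ) (g : M →ₗ[𝓞 K] N) {B : ℝ}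
    (hB : 0 ≤ B) (hg : ∀ j y, HeightOneSpectrum.adicAbv K v (φ j (g y)) ≤ B) (j : ι) (y : M) :
    HeightOneSpectrum.adicAbv K v (φ j (g y)) ≤ opNormAt v ⊤ L g := by
  -- The bound `B` only serves to show that some admissible constant exists; the infimum of an empty
  -- set would be `0`.
  refine le_csInf ⟨B, hB, h.opNorm_bound v g hB hg⟩ fun c hc => ?_
  have h1 := (h.adicAbv_form_le_latticeNorm v j (g y)).trans (hc.2 (1 ⊗ₜ y))
  have h2 : latticeNorm v (⊤ : Submodule (𝓞 K) M) (1 ⊗ₜ y) ≤ 1 :=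
    (latticeNorm_le v 1 (Submodule.subset_span ⟨y, Submodule.mem_top, rfl⟩)
      (one_smul _ _).symm).trans_eq
      norm_one
  exact h1.trans (mul_le_of_le_one_right hc.1 h2)

end LatticeNorms

/-! ### Growth of the coefficients and the product formula -/

section Arithmetic

variable {K : Type u} [Field K]

/-- A bound `A` on `w (a_l) r ^ l` gives `w (a_l) ≤ exp (log (max A 1) - l log r)`. The exponent `l
+ 1` in place of `l` absorbs the constant `A`, also at `l = 0`. -/
lemma PositiveRadius.exists_le_exp {w : K → ℝ} {a : K⟦X⟧} (h : PositiveRadius w a) :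
    ∃ c : ℝ, 0 ≤ c ∧ ∀ l : ℕ, w (coeff l a) ≤ Real.exp (c * (l + 1)) := by
  obtain ⟨r, hr, A, hA⟩ := h
  have hlog : 0 ≤ Real.log (max A 1) := Real.log_nonneg (le_max_right _ _)
  refine ⟨|Real.log r| + Real.log (max A 1), by positivity, fun l => ?_⟩
  have h1 : w (coeff l a) * r ^ l ≤ max A 1 := (hA ⟨l, rfl⟩).trans (le_max_left _ _)
  rw [← le_div_iff₀ (pow_pos hr l)] at h1
  refine h1.trans ?_
  rw [← Real.exp_log (show 0 < max A 1 / r ^ l by positivity), Real.exp_le_exp,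
    Real.log_div (by positivity) (by positivity), Real.log_pow]
  have hl : (0 : ℝ) ≤ l := Nat.cast_nonneg l
  nlinarith [neg_abs_le (Real.log r), abs_nonneg (Real.log r), mul_nonneg hl hlog,
    mul_nonneg hl (show 0 ≤ |Real.log r| + Real.log r by linarith [neg_abs_le (Real.log r)])]

variable [NumberField K]

lemma adicAbv_support_finite {a : K} (ha : a ≠ 0) :
    {v : HeightOneSpectrum (𝓞 K) | HeightOneSpectrum.adicAbv K v a ≠ 1}.Finite := by
  have h := (FinitePlace.hasFiniteMulSupport ha).image FinitePlace.maximalIdeal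
  refine h.subset fun v hv => ⟨FinitePlace.mk v, ?_, FinitePlace.maximalIdeal_mk v⟩
  rw [Function.mem_mulSupport, FinitePlace.mk_apply, FinitePlace.norm_embedding]
  exact hv

lemma summable_log_adicAbv {a : K} (ha : a ≠ 0) :
    Summable fun v : HeightOneSpectrum (𝓞 K) => Real.log (HeightOneSpectrum.adicAbv K v a) := by
  refine summable_of_hasFiniteSupport ((adicAbv_support_finite ha).subset fun v hv h => hv ?_)
  dsimp only
  rw [h, Real.log_one]

/-- The product formula. -/
lemma tsum_log_adicAbv {a : K} (ha : a ≠ 0) :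
    ∑' v : HeightOneSpectrum (𝓞 K), Real.log (HeightOneSpectrum.adicAbv K v a) =
      -Real.log |(Algebra.norm ℚ a : ℝ)| := by
  have hfin := adicAbv_support_finite ha
  have h1 := FinitePlace.prod_eq_inv_abs_norm ha
  rw [← finprod_comp_equiv FinitePlace.equivHeightOneSpectrum.symm] at h1
  have h2 (v : HeightOneSpectrum (𝓞 K)) :
      FinitePlace.equivHeightOneSpectrum.symm v a = HeightOneSpectrum.adicAbv K v a :=
    FinitePlace.norm_embedding v a
  simp only [h2] at h1
  rw [finprod_eq_prod_of_mulSupport_subset (s := hfin.toFinset) _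
    (fun v hv => by simpa using hv)] at h1
  rw [tsum_eq_sum (s := hfin.toFinset), ← Real.log_prod, h1, Rat.cast_inv, Real.log_inv,
    Rat.cast_abs]
  · exact fun v _ => (HeightOneSpectrum.adicAbv K v).ne_zero ha
  · intro v hv
    simp only [Set.Finite.mem_toFinset, Set.mem_ofPred_eq, not_not] at hv
    rw [hv, Real.log_one]

/-- The norm of the rational integer `n!` is its power with exponent `[K : ℚ]`, and `n! ≤ n ^ n`. -/
lemma neg_tsum_log_adicAbv_factorial_le (n : ℕ) :
    -∑' v : HeightOneSpectrum (𝓞 K), Real.log (HeightOneSpectrum.adicAbv K v (n.factorial : K)) ≤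
      Module.finrank ℚ K * (n * Real.log n) := by
  rw [tsum_log_adicAbv (Nat.cast_ne_zero.mpr n.factorial_ne_zero), neg_neg,
    ← map_natCast (algebraMap ℚ K), Algebra.norm_algebraMap]
  push_cast
  rw [abs_of_nonneg (by positivity), Real.log_pow]
  refine mul_le_mul_of_nonneg_left ?_ (Nat.cast_nonneg _)
  rw [← Real.log_pow]
  exact Real.log_le_log (Nat.cast_pos.mpr n.factorial_pos) (mod_cast n.factorial_le_pow)

lemma adicAbv_factorial_pos (v : HeightOneSpectrum (𝓞 K)) (l : ℕ) :
    0 < HeightOneSpectrum.adicAbv K v (l.factorial : K) :=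
  (HeightOneSpectrum.adicAbv K v).pos (Nat.cast_ne_zero.mpr l.factorial_ne_zero)

/-- Holds since `l!` divides `n!`. It lets the factor `|i!|_v ^ (-α)` serve for all coefficients of
order at most `i`. -/
lemma adicAbv_factorial_anti (v : HeightOneSpectrum (𝓞 K)) {l n : ℕ} (h : l ≤ n) :
    HeightOneSpectrum.adicAbv K v (n.factorial : K) ≤
      HeightOneSpectrum.adicAbv K v (l.factorial : K) := by
  obtain ⟨c, hc⟩ := Nat.factorial_dvd_factorial h
  rw [hc, Nat.cast_mul, map_mul]
  exact mul_le_of_le_one_right ((HeightOneSpectrum.adicAbv K v).nonneg _)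
    (HeightOneSpectrum.adicAbv_natCast_le_one K v c)

/-- The coefficients of an `LG`-germ grow at most geometrically, up to the factorial factor, with
summable exponents. -/
lemma IsLGGerm.exists_summable_bound {α : ℝ} (hα : 0 ≤ α) {m : ℕ} {f : Fin m → K⟦X⟧}
    (hf : IsLGGerm α f) :
    ∃ β : HeightOneSpectrum (𝓞 K) → ℝ, (∀ v, 0 ≤ β v) ∧ Summable β ∧ ∀ v k (l : ℕ),
      HeightOneSpectrum.adicAbv K v (coeff l (f k)) ≤
        Real.exp (β v * (l + 1)) / HeightOneSpectrum.adicAbv K v (l.factorial : K) ^ α := by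
  classical
  obtain ⟨hrad, S, Cv, hS, B, hB⟩ := hf
  choose c hc0 hc using fun v k => ((hrad k).1 v).exists_le_exp
  -- At exceptional places the exponent comes from the radius of convergence, elsewhere from `C_v`.
  -- Replacing `C_v` by `max 1 C_v` makes it nonnegative.
  refine ⟨fun v => if v ∈ S then ∑ k, c v k else Real.log (max 1 (Cv v)), fun v => ?_, ?_,
    fun v k l => ?_⟩
  · dsimp only
    split_ifs
    · exact Finset.sum_nonneg fun k _ => hc0 v k
    · exact Real.log_nonneg (le_max_left _ _)
  · rw [← S.summable_compl_iff]
    refine summable_of_sum_le (c := Real.log B) (fun v => ?_) fun T => ?_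
    · simp only [if_neg v.2]
      exact Real.log_nonneg (le_max_left _ _)
    · have h1 (v : {v // v ∉ S}) :
          (if v.1 ∈ S then ∑ k, c v.1 k else Real.log (max 1 (Cv v.1))) =
            if 1 ≤ Cv v.1 then Real.log (Cv v.1) else 0 := by
        rw [if_neg v.2]
        split_ifs with h
        · rw [max_eq_right h]
        · rw [max_eq_left (not_le.mp h).le, Real.log_one]
      -- Only the places of `T` with `C_v ≥ 1` contribute. They again form a finite set outside `S`,
      -- so the bound on all finite products applies to them.
      rw [Finset.sum_congr rfl fun v _ => h1 v, ← Finset.sum_filter,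
        ← Real.log_prod fun v _ => (hS v.1 v.2).1.ne']
      exact Real.log_le_log (Finset.prod_pos fun v _ => (hS v.1 v.2).1) (hB ⟨_, rfl⟩)
  · have hpos := adicAbv_factorial_pos v l
    have hl : (0 : ℝ) ≤ l := Nat.cast_nonneg l
    dsimp only
    split_ifs with hv
    · rw [le_div_iff₀ (Real.rpow_pos_of_pos hpos α)]
      -- At an exceptional place the factorial is not needed: since `α ≥ 0`, dividing by this factor
      -- only weakens the bound.
      have h1 : HeightOneSpectrum.adicAbv K v (l.factorial : K) ^ α ≤ 1 :=
        Real.rpow_le_one hpos.le (HeightOneSpectrum.adicAbv_natCast_le_one K v _) hα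
      refine (mul_le_of_le_one_right ((HeightOneSpectrum.adicAbv K v).nonneg _) h1).trans
        ((hc v k l).trans (Real.exp_le_exp.mpr ?_))
      exact mul_le_mul_of_nonneg_right
        (Finset.single_le_sum (fun k _ => hc0 v k) (Finset.mem_univ k)) (by positivity)
    · refine ((hS v hv).2 k l).trans (div_le_div_of_nonneg_right ?_ (by positivity))
      have h1 : 1 ≤ max 1 (Cv v) := le_max_left _ _
      have h2 : Real.exp (Real.log (max 1 (Cv v)) * (l + 1)) = max 1 (Cv v) ^ (l + 1) := by
        rw [← Real.rpow_natCast, Real.rpow_def_of_pos (by positivity)]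
        push_cast
        rfl
      rw [h2]
      exact (pow_le_pow_left₀ (hS v hv).1.le (le_max_right _ _) l).trans
        (pow_le_pow_right₀ h1 l.le_succ)

end Arithmetic

/-! ### Coordinates on the leading terms -/

section Coordinates

variable {K : Type u} [Field K]

lemma Jet.mk_surjective (n : ℕ) : Function.Surjective (Jet.mk n : K⟦X⟧ → Jet K n) :=
  Ideal.Quotient.mk_surjective

lemma Jet.mk_eq_zero_iff {n : ℕ} {g : K⟦X⟧} : Jet.mk n g = 0 ↔ ∀ l < n, coeff l g = 0 := by
  rw [← X_pow_dvd_iff, ← Ideal.mem_span_singleton]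
  exact Ideal.Quotient.eq_zero_iff_mem

lemma Jet.restrict_mk (i : ℕ) (g : K⟦X⟧) : Jet.restrict K i (Jet.mk (i + 1) g) = Jet.mk i g := rfl

/-- The coefficient of `Z ^ i` of a jet on the `(i + 1)`-st infinitesimal neighbourhood. -/
noncomputable def Jet.topCoeff (i : ℕ) : Jet K (i + 1) →ₗ[𝓞 K] K where
  toFun := QuotientAddGroup.lift (Ideal.span {(X : K⟦X⟧) ^ (i + 1)}).toAddSubgroup
    (coeff (R := K) i).toAddMonoidHom fun _ h =>
      X_pow_dvd_iff.mp (Ideal.mem_span_singleton.mp h) i i.lt_succ_self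
  map_add' := map_add _
  map_smul' r w := by
    obtain ⟨g, rfl⟩ := Jet.mk_surjective _ w
    rw [Jet.smul_mk]
    exact (coeff_C_mul _ _ _).trans (Algebra.smul_def _ _).symm

lemma Jet.topCoeff_mk (i : ℕ) (g : K⟦X⟧) : Jet.topCoeff i (Jet.mk (i + 1) g) = coeff i g := rfl

/-- The coordinates of leading terms. -/
noncomputable def leadingCoord (s i : ℕ) (j : Fin s) : LeadingTerms K s i →ₗ[𝓞 K] K :=
  Jet.topCoeff i ∘ₗ LinearMap.proj j ∘ₗ (LeadingTerms K s i).subtype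

variable (K) in
/-- The leading term that is `Z ^ i` at one point and vanishes at the others. -/
noncomputable def leadingMonomial (s i : ℕ) (j : Fin s) : LeadingTerms K s i :=
  ⟨fun k => Jet.mk (i + 1) (if k = j then X ^ i else 0), LinearMap.mem_ker.mpr <| funext fun k => by
    change Jet.mk i (if k = j then (X : K⟦X⟧) ^ i else 0) = 0
    refine Jet.mk_eq_zero_iff.mpr fun l hl => ?_
    split_ifs
    · rw [coeff_X_pow, if_neg hl.ne]
    · exact map_zero _⟩

/-- Restriction to order `i` kills the coefficients below `Z ^ i`, so the top coefficient at each
point is all that remains of a leading term. -/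
lemma isIntegralBasis_leadingMonomial (s i : ℕ) :
    IsIntegralBasis (integralLeadingTerms K s i) (leadingMonomial K s i) (leadingCoord s i) where
  mem j k := ⟨if k = j then X ^ i else 0, by
    refine congrArg (Jet.mk (i + 1)) ?_
    split_ifs
    · rw [map_pow, map_X]
    · rw [map_zero]⟩
  form_apply j k := by
    change coeff i (if j = k then (X : K⟦X⟧) ^ i else 0) = _
    split_ifs
    · rw [coeff_X_pow_self]
    · exact map_zero _
  eq_zero y hy := by
    refine Subtype.ext (funext fun j => ?_)
    obtain ⟨g, hg⟩ := Jet.mk_surjective _ (y.1 j)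
    have h1 : Jet.restrict K i (y.1 j) = 0 := congrFun (LinearMap.mem_ker.mp y.2) j
    have h2 : Jet.topCoeff i (y.1 j) = 0 := hy j
    rw [← hg, Jet.restrict_mk, Jet.mk_eq_zero_iff] at h1
    rw [← hg, Jet.topCoeff_mk] at h2
    change y.1 j = 0
    rw [← hg, Jet.mk_eq_zero_iff]
    intro l hl
    rcases Nat.lt_succ_iff_lt_or_eq.mp hl with hl | rfl
    · exact h1 l hl
    · exact h2
  integral j y hy := by
    obtain ⟨g, hg⟩ := hy j
    refine ⟨coeff i g, ?_⟩
    change _ = Jet.topCoeff i (y.1 j)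
    rw [hg, Jet.topCoeff_mk, coeff_map]

end Coordinates

/-! ### The estimate for `γ_x^i` -/

section Bound

variable {K : Type u} [Field K] [NumberField K] {𝒳 : Scheme.{u}} {π : 𝒳 ⟶ Spec (.of (𝓞 K))}
  {E H : 𝒳.Modules} {s m : ℕ} {P : Fin s → (Spec (.of (𝓞 K)) ⟶ 𝒳)}
  (F : ∀ j, FormalFrame π E H (P j) m) (hH : IsVectorBundle H 1) (f : Fin s → Fin m → K⟦X⟧)

/-- The coefficients of `γ_x^i` are bounded by the coefficients of the germs. -/
lemma adicAbv_leadingCoord_gamma_le (v : HeightOneSpectrum (𝓞 K)) (x i : ℕ) {B : ℝ} (hB : 0 ≤ B)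
    (hf : ∀ j k, ∀ l ≤ i, HeightOneSpectrum.adicAbv K v (coeff l (f j k)) ≤ B) (j : Fin s)
    (y : Gr F hH f x i) :
    HeightOneSpectrum.adicAbv K v (leadingCoord s i j (gamma F hH f x i y)) ≤ B := by
  obtain ⟨t, rfl⟩ := Submodule.mkQ_surjective _ y
  -- By unfolding, the `j`-th coordinate of the class of `t` is the `i`-th coefficient of `⟨t;
  -- f_j⟩`.
  exact adicAbv_coeff_pairing_le v (F j) hH (f j) x t.1 hB (hf j)

theorem exists_opNormAt_gamma_bound {α : ℝ} (hα : 0 ≤ α) (hf : ∀ j, IsLGGerm α (f j)) :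
    ∃ C : ℝ, ∀ x i : ℕ, 1 ≤ i + x → gamma F hH f x i ≠ 0 →
      (∀ v : HeightOneSpectrum (𝓞 K),
        0 < opNormAt v ⊤ (integralLeadingTerms K s i) (gamma F hH f x i)) ∧
      Summable (fun v : HeightOneSpectrum (𝓞 K) =>
        Real.log (opNormAt v ⊤ (integralLeadingTerms K s i) (gamma F hH f x i))) ∧
      ∑' v : HeightOneSpectrum (𝓞 K),
        Real.log (opNormAt v ⊤ (integralLeadingTerms K s i) (gamma F hH f x i)) ≤
      (Module.finrank ℚ K : ℝ) * α * i * Real.log i + C * ((i : ℝ) + x) := by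
  choose β hβ0 hβs hβ using fun j => (hf j).exists_summable_bound hα
  let b (v : HeightOneSpectrum (𝓞 K)) : ℝ := ∑ j, β j v
  have hb0 (v) : 0 ≤ b v := Finset.sum_nonneg fun j _ => hβ0 j v
  have hbs : Summable b := summable_sum fun j _ => hβs j
  -- The local bounds contribute `(∑ b_v) (i + 1)`, and `i + 1 ≤ 2 (i + x)` because `i` and `x` are
  -- not both zero.
  refine ⟨2 * ∑' v, b v, fun x i hix hγ => ?_⟩
  set ν := fun v : HeightOneSpectrum (𝓞 K) =>
    opNormAt v ⊤ (integralLeadingTerms K s i) (gamma F hH f x i)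
  let ρ (v : HeightOneSpectrum (𝓞 K)) : ℝ := HeightOneSpectrum.adicAbv K v (i.factorial : K)
  have hρ (v) : 0 < ρ v := adicAbv_factorial_pos v i
  let B (v : HeightOneSpectrum (𝓞 K)) : ℝ := Real.exp (b v * (i + 1)) / ρ v ^ α
  have hB (v) : 0 < B v := div_pos (Real.exp_pos _) (Real.rpow_pos_of_pos (hρ v) α)
  have hfB (v) (j k) (l : ℕ) (hl : l ≤ i) :
      HeightOneSpectrum.adicAbv K v (coeff l (f j k)) ≤ B v := by
    refine (hβ j v k l).trans (div_le_div₀ (Real.exp_pos _).le (Real.exp_le_exp.mpr ?_)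
      (Real.rpow_pos_of_pos (hρ v) α)
      (Real.rpow_le_rpow (hρ v).le (adicAbv_factorial_anti v hl) hα))
    have h1 : β j v ≤ b v :=
      Finset.single_le_sum (f := fun j => β j v) (fun j _ => hβ0 j v) (Finset.mem_univ j)
    have h2 : (l : ℝ) ≤ i := Nat.cast_le.mpr hl
    exact mul_le_mul h1 (by linarith) (by positivity) (hb0 v)
  have hγB (v) (j) (y) := adicAbv_leadingCoord_gamma_le F hH f v x i (hB v).le (hfB v) j y
  have hbasis := isIntegralBasis_leadingMonomial (K := K) s i
  obtain ⟨y, j, hc⟩ : ∃ y j, leadingCoord s i j (gamma F hH f x i y) ≠ 0 := by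
    by_contra! h
    exact hγ (LinearMap.ext fun y => hbasis.eq_zero _ (h y))
  set c := leadingCoord s i j (gamma F hH f x i y)
  have hlow (v) : HeightOneSpectrum.adicAbv K v c ≤ ν v :=
    hbasis.le_opNormAt v (gamma F hH f x i) (hB v).le (hγB v) j y
  have hup (v) : ν v ≤ B v := hbasis.opNormAt_le v (gamma F hH f x i) (hB v).le (hγB v)
  have hcpos (v : HeightOneSpectrum (𝓞 K)) : 0 < HeightOneSpectrum.adicAbv K v c :=
    (HeightOneSpectrum.adicAbv K v).pos hc
  have hpos (v) : 0 < ν v := (hcpos v).trans_le (hlow v)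
  have hlogup (v) : Real.log (ν v) ≤ b v * (i + 1) - α * Real.log (ρ v) := by
    refine (Real.log_le_log (hpos v) (hup v)).trans_eq ?_
    rw [Real.log_div (Real.exp_ne_zero _) (Real.rpow_pos_of_pos (hρ v) α).ne', Real.log_exp,
      Real.log_rpow (hρ v)]
  have hρs : Summable fun v => Real.log (ρ v) :=
    summable_log_adicAbv (K := K) (Nat.cast_ne_zero.mpr i.factorial_ne_zero)
  have hups : Summable fun v => b v * (i + 1) - α * Real.log (ρ v) :=
    (hbs.mul_right _).sub (hρs.mul_left α)
  have hlows := summable_log_adicAbv hc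
  have hsum : Summable fun v => Real.log (ν v) := by
    -- The difference `log ‖γ‖_v - log |c|_v` is nonnegative and dominated by a summable family.
    -- Adding back the summable `log |c|_v` gives the claim.
    have h := Summable.of_nonneg_of_le
      (fun v => sub_nonneg.mpr (Real.log_le_log (hcpos v) (hlow v)))
      (fun v => sub_le_sub_right (hlogup v) _) (hups.sub hlows)
    simpa using h.add hlows
  refine ⟨hpos, hsum, (hsum.tsum_le_tsum hlogup hups).trans ?_⟩
  rw [(hbs.mul_right _).tsum_sub (hρs.mul_left α), tsum_mul_right, tsum_mul_left]
  have h1 := mul_le_mul_of_nonneg_left (neg_tsum_log_adicAbv_factorial_le (K := K) i) hα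
  have h2 : (1 : ℝ) ≤ i + x := mod_cast hix
  have h3 : (0 : ℝ) ≤ x := Nat.cast_nonneg x
  have h4 : (∑' v, b v) * (i + 1) ≤ (∑' v, b v) * (2 * (i + x)) :=
    mul_le_mul_of_nonneg_left (by linarith) (tsum_nonneg hb0)
  linarith

end Bound

end LGGerms

theorem mainTheorem8 {K : Type u} [Field K] [NumberField K]
    {𝒳 : Scheme.{u}} [AlgebraicGeometry.IsIntegral 𝒳]
    (π : 𝒳 ⟶ Spec (.of (𝓞 K))) [IsProper π] [Flat π]
    [SmoothOfRelativeDimension 1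
      (Limits.pullback.snd π (Spec.map (CommRingCat.ofHom (algebraMap (𝓞 K) K))))]
    (E H : 𝒳.Modules) (m s : ℕ)
    (hE : LGGerms.IsVectorBundle E m) (hH : LGGerms.IsVectorBundle H 1)
    (P : Fin s → (Spec (.of (𝓞 K)) ⟶ 𝒳)) (hP : ∀ j, P j ≫ π = 𝟙 _)
    (hdisj : Pairwise fun j k => Disjoint (Set.range (P j)) (Set.range (P k)))
    (F : ∀ j, LGGerms.FormalFrame π E H (P j) m)
    (α : ℝ) (hα : 0 ≤ α)
    (f : Fin s → Fin m → K⟦X⟧) (hf : ∀ j, LGGerms.IsLGGerm α (f j)) :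
    ∃ C : ℝ, ∀ x i : ℕ, 1 ≤ i + x → LGGerms.gamma F hH f x i ≠ 0 →
      (∀ v : HeightOneSpectrum (𝓞 K), 0 < LGGerms.opNormAt v ⊤
        (LGGerms.integralLeadingTerms K s i) (LGGerms.gamma F hH f x i)) ∧
      Summable (fun v : HeightOneSpectrum (𝓞 K) => Real.log (LGGerms.opNormAt v ⊤
        (LGGerms.integralLeadingTerms K s i) (LGGerms.gamma F hH f x i))) ∧
      ∑' v : HeightOneSpectrum (𝓞 K), Real.log (LGGerms.opNormAt v ⊤
        (LGGerms.integralLeadingTerms K s i) (LGGerms.gamma F hH f x i)) ≤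
      (Module.finrank ℚ K : ℝ) * α * i * Real.log i + C * ((i : ℝ) + x) :=
  LGGerms.exists_opNormAt_gamma_bound F hH f hα hf
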